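/- **Setting.** Let $\Theta\subset\mathbb{R}^p$ and $\mathcal{S}\subset\mathbb{R}^q$ be open, $\theta_0\in\Theta$, and for each $N\in\mathbb{N}$ let $(\mathbf{P}^{(N)}_\theta)_{\theta\in\Theta}$ be probability measures on a measurable space $\mathscr{X}^{(N)}$, with observation $x^N$, and let $D_N$ be a non-degenerate $p\times p$ matrix. For each $N$ let $\Pi_N(d\theta|x)$ (the quasi-posterior) be a probability kernel from $\mathscr{X}^{(N)}$ to $\Theta$, $Q_N(\theta,d\vartheta|x)$ (the proposal) a probability kernel from $\mathscr{X}^{(N)}\times\Theta$ to $\Theta$, and $A_N(\theta,\vartheta|x)\in[0,1]$ a measurable function such that for every $x\in\mathscr{X}^{(N)}$, as measures on $\Theta^2$, $$\Pi_N(d\theta|x)Q_N(\theta,d\vartheta|x)A_N(\theta,\vartheta|x)=\Pi_N(d\vartheta|x)Q_N(\vartheta,d\theta|x)A_N(\vartheta,\theta|x).$$ Given $x^N=x$, let $\theta^N_0,\theta^N_1,\dots$ be the Markov chain with $\theta^N_0\sim\Pi_N(\cdot|x)$ and transition kernel $$P_N(\theta,d\vartheta|x)=Q_N(\theta,d\vartheta|x)A_N(\theta,\vartheta|x)+R_N(\theta|x)\,\delta_\theta(d\vartheta),\qquad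 R_N(\theta|x)=1-\int Q_N(\theta,d\vartheta|x)A_N(\theta,\vartheta|x),$$ and let $F^N_M=\frac1M\sum_{m=0}^{M-1}\delta_{\theta^N_m}$. For a measure $F$ on $\Theta$, $F(\theta_0+D_N^{-1}du)$ denotes its image under $\theta\mapsto u=D_N(\theta-\theta_0)$; similarly for pairs. Put $\|\mu-\nu\|_{\mathrm{TV}}=\sup_{|f|\le1}|\int f\,d\mu-\int f\,d\nu|$ over measurable $f$, and let $\|\mu-\nu\|_{\mathrm{BL}}$ be the same supremum over measurable $f$ with $|f|\le 1$ and $|f(x)-f(y)|\le\|x-y\|$. For $s\in\mathcal{S}$ let $\Pi(du|s)=\pi(u|s)\,du$ and $Q(u,dv|s)=q(u,v|s)\,dv$ be probability kernels with jointly measurable densities, let $A(u,v|s)\in[0,1]$ be jointly measurable, and put $$P(u,dv|s)=Q(u,dv|s)A(u,v|s)+R(u|s)\,\delta_u(dv),\qquad R(u|s)=1-\int Q(u,dv|s)A(u,v|s).$$ Let $s_N:\mathscr{X}^{(N)}\to\mathcal{S}$ be measurable. **Proposition.** Suppose that 1. for each $s\in\mathcal{S}$, the kernel $P(u,dv|s)$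 is ergodic, i.e. irreducible and positive recurrent, with invariant probability measure $\Pi(du|s)$; 2. the laws of $s_N$ under $\mathbf{P}^{(N)}_{\theta_0}$, $N\in\mathbb{N}$, are tight in $\mathcal{S}$; 3. for each $u,v\in\mathbb{R}^p$ the functions $\pi(u|s)$, $q(u,v|s)$, $A(u,v|s)$ are continuous in $s$, and $\sup_{s\in K}\sup_{u,v\in\mathbb{R}^p}\{\pi(u|s)+q(u,v|s)\}<\infty$ for every compact $K\subset\mathcal{S}$; 4. for each $u,v\in\mathbb{R}^p$, $A_N(\theta_0+D_N^{-1}u,\theta_0+D_N^{-1}v|x^N)-A(u,v|s_N)\to0$ in $\mathbf{P}^{(N)}_{\theta_0}$-probability as $N\to\infty$ (the difference being read as $0$ for those $N$ for which $\theta_0+D_N^{-1}u$ or $\theta_0+D_N^{-1}v$ is not in $\Theta$); 5. $\big\|\Pi_N(\theta_0+D_N^{-1}du|x^N)\,Q_N(\theta_0+D_N^{-1}u,\theta_0+D_N^{-1}dv|x^N)-\Pi(du|s_N)\,Q(u,dv|s_N)\big\|_{\mathrm{TV}}\to0$ in $\mathbf{P}^{(N)}_{\theta_0}$-probability as $N\to\infty$.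 Then the family of Markov chain Monte Carlo methods is locally consistent at $\theta_0$: as $N,M\to\infty$, $$\big\|\Pi_N(\theta_0+D_N^{-1}du|x^N)-F^N_M(\theta_0+D_N^{-1}du)\big\|_{\mathrm{BL}}\to0$$ in probability, under the joint law of $x^N\sim\mathbf{P}^{(N)}_{\theta_0}$ and of the chain generated from $x^N$. -/

import Mathlib

open MeasureTheory ProbabilityTheory Filter Topology
open scoped ENNReal NNReal

noncomputable section

/-! ### Distances between measures and convergence in probability -/

/-- The total variation distance `sup_{|f| ≤ 1} |∫ f dμ - ∫ f dν|`, over measurable `f`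
(used for probability measures). -/
def tvDist {E : Type*} [MeasurableSpace E] (μ ν : Measure E) : ℝ :=
  ⨆ f : {f : E → ℝ // Measurable f ∧ ∀ x, |f x| ≤ 1}, |∫ x, f.1 x ∂μ - ∫ x, f.1 x ∂ν|

/-- The bounded Lipschitz distance: the supremum of `|∫ f dμ - ∫ f dν|` over measurable `f` with
`|f| ≤ 1` and `|f x - f y| ≤ ‖x - y‖` (used for probability measures). -/
def blDist {E : Type*} [NormedAddCommGroup E] [MeasurableSpace E] (μ ν : Measure E) : ℝ :=
  ⨆ f : {f : E → ℝ // Measurable f ∧ (∀ x, |f x| ≤ 1) ∧ ∀ x y, |f x - f y| ≤ ‖x - y‖},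
    |∫ x, f.1 x ∂μ - ∫ x, f.1 x ∂ν|

/-- `Y i → 0` in `μ i`-probability along the filter `l`; the probability space may depend
on the index. -/
def TendstoZeroInProb {ι : Type*} {Ω : ι → Type*} [∀ i, MeasurableSpace (Ω i)]
    (l : Filter ι) (μ : ∀ i, Measure (Ω i)) (Y : ∀ i, Ω i → ℝ) : Prop :=
  ∀ ε : ℝ, 0 < ε → Tendsto (fun i => μ i {ω | ε ≤ |Y i ω|}) l (𝓝 0)

/-! ### Metropolis--Hastings kernels -/

section Metropolis

variable {α β : Type*} [MeasurableSpace α] [MeasurableSpace β]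

/-- With a parameter `a : α`, the kernel
`P(θ, dϑ | a) = Q(θ, dϑ | a) A(θ, ϑ | a) + R(θ | a) δ_θ(dϑ)`, where
`R(θ | a) = 1 - ∫ Q(θ, dϑ | a) A(θ, ϑ | a)`. -/
def metropolisKernel (Q : Kernel (α × β) β) [IsSFiniteKernel Q] (A : α → β → β → unitInterval) :
    Kernel (α × β) β :=
  Q.withDensity (fun z v => ENNReal.ofReal (A z.1 z.2 v)) +
    (Kernel.deterministic (Prod.snd : α × β → β) measurable_snd).withDensity
      (fun z _ => 1 - ∫⁻ v, ENNReal.ofReal (A z.1 z.2 v) ∂(Q z))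

theorem isMarkovKernel_metropolisKernel (Q : Kernel (α × β) β) [IsMarkovKernel Q]
    (A : α → β → β → unitInterval)
    (hA : Measurable fun z : (α × β) × β => A z.1.1 z.1.2 z.2) :
    IsMarkovKernel (metropolisKernel Q A) := by
  have h1 : Measurable (Function.uncurry fun (z : α × β) (v : β) =>
      ENNReal.ofReal (A z.1 z.2 v)) :=
    ENNReal.measurable_ofReal.comp (measurable_subtype_coe.comp hA)
  have h2 : Measurable (Function.uncurry fun (z : α × β) (_ : β) =>
      1 - ∫⁻ v, ENNReal.ofReal (A z.1 z.2 v) ∂(Q z)) :=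
    (measurable_const.sub (Measurable.lintegral_kernel_prod_right h1)).comp measurable_fst
  refine ⟨fun z => ⟨?_⟩⟩
  have h3 : ∫⁻ v, ENNReal.ofReal (A z.1 z.2 v) ∂(Q z) ≤ 1 := by
    calc ∫⁻ v, ENNReal.ofReal (A z.1 z.2 v) ∂(Q z) ≤ ∫⁻ _, 1 ∂(Q z) :=
          lintegral_mono fun v => ENNReal.ofReal_le_one.2 (A z.1 z.2 v).2.2
      _ = 1 := by simp
  rw [metropolisKernel, add_apply, Measure.add_apply, Kernel.withDensity_apply' _ h1,
    Kernel.withDensity_apply' _ h2]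
  simp only [Measure.restrict_univ, lintegral_const, measure_univ, mul_one]
  exact add_tsub_cancel_of_le h3

end Metropolis

/-- A Metropolis--Hastings algorithm on the parameter space `T` for data in `𝒳`: the target
(quasi-posterior) kernel `Π(dθ | x)`, the proposal kernel `Q(θ, dϑ | x)` and the acceptance
probability `A(θ, ϑ | x)`, subject to the detailed balance
`Π(dθ | x) Q(θ, dϑ | x) A(θ, ϑ | x) = Π(dϑ | x) Q(ϑ, dθ | x) A(ϑ, θ | x)`. -/
structure MetropolisHastings (𝒳 T : Type*) [MeasurableSpace 𝒳] [MeasurableSpace T] where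
  target : Kernel 𝒳 T
  proposal : Kernel (𝒳 × T) T
  accept : 𝒳 → T → T → unitInterval
  isMarkovKernel_target : IsMarkovKernel target
  isMarkovKernel_proposal : IsMarkovKernel proposal
  measurable_accept : Measurable fun z : (𝒳 × T) × T => accept z.1.1 z.1.2 z.2
  balance : ∀ x,
    ((target x ⊗ₘ proposal.sectR x).withDensity
        fun z => ENNReal.ofReal (accept x z.1 z.2)).map Prod.swap =
      (target x ⊗ₘ proposal.sectR x).withDensity fun z => ENNReal.ofReal (accept x z.1 z.2)

namespace MetropolisHastings

variable {𝒳 T : Type*} [MeasurableSpace 𝒳] [MeasurableSpace T] (M : MetropolisHastings 𝒳 T)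

instance : IsMarkovKernel M.target := M.isMarkovKernel_target

instance : IsMarkovKernel M.proposal := M.isMarkovKernel_proposal

/-- The transition kernel `P(θ, dϑ | x)` of the algorithm. -/
def kernel : Kernel (𝒳 × T) T := metropolisKernel M.proposal M.accept

instance : IsMarkovKernel M.kernel :=
  isMarkovKernel_metropolisKernel M.proposal M.accept M.measurable_accept

/-- One step of the algorithm together with the data: `(x, θ) ↦ (x, ϑ)` with
`ϑ ∼ P(θ, dϑ | x)`. -/
def step : Kernel (𝒳 × T) (𝒳 × T) :=
  Kernel.deterministic Prod.fst measurable_fst ×ₖ M.kernel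

instance : IsMarkovKernel M.step := by unfold step; infer_instance

/-- Given the data `x`, the law on `ℕ → T` of the Markov chain `θ_0, θ_1, …` with
`θ_0 ∼ Π(dθ | x)` and transition kernel `P(θ, dϑ | x)`. It is built as the law of the second
coordinate of the chain `(x, θ_m)`, which starts from `δ_x ⊗ Π(dθ | x)` and moves by `step`. -/
def chain : Kernel 𝒳 (ℕ → T) :=
  (Kernel.traj (X := fun _ : ℕ => 𝒳 × T)
      (fun n => M.step.comap (fun h => h ⟨n, Finset.mem_Iic.2 le_rfl⟩) (measurable_pi_apply _)) 0
    ∘ₖ (Kernel.id ×ₖ M.target).map fun z (_ : Finset.Iic 0) => z).map fun ω m => (ω m).2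

end MetropolisHastings

/-! ### Local consistency -/

/-- The empirical distribution `M⁻¹ ∑_{m < M} δ_{θ_m}`. -/
def empiricalDist {T : Type*} [MeasurableSpace T] (M : ℕ) (θ : ℕ → T) : Measure T :=
  (M : ℝ≥0∞)⁻¹ • ∑ m ∈ Finset.range M, Measure.dirac (θ m)

/-- The local coordinate `u = D (θ - θ₀)`. The image of a measure `F(dθ)` under this map is
the rescaled measure `F(θ₀ + D⁻¹ du)`. -/
def localCoord {p : ℕ} {Θ : Set (EuclideanSpace ℝ (Fin p))} (D : Matrix (Fin p) (Fin p) ℝ)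
    (θ₀ θ : Θ) : EuclideanSpace ℝ (Fin p) :=
  Matrix.toEuclideanCLM (𝕜 := ℝ) D ((θ : EuclideanSpace ℝ (Fin p)) - θ₀)

/-- The parameter `θ₀ + D⁻¹ u`, which need not lie in `Θ`. -/
def localParam {p : ℕ} {Θ : Set (EuclideanSpace ℝ (Fin p))} (D : Matrix (Fin p) (Fin p) ℝ)
    (θ₀ : Θ) (u : EuclideanSpace ℝ (Fin p)) : EuclideanSpace ℝ (Fin p) :=
  θ₀ + Matrix.toEuclideanCLM (𝕜 := ℝ) D⁻¹ u

/-- Local consistency at `θ₀`: the bounded Lipschitz distance between the rescaled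
quasi-posterior and the rescaled empirical distribution of the first `M` states of the chain
tends to `0` as `N, M → ∞`, in probability under the joint law of the data `x ∼ P N` and of the
chain generated from them. -/
def LocallyConsistent {p : ℕ} {Θ : Set (EuclideanSpace ℝ (Fin p))} {𝒳 : ℕ → Type*}
    [∀ N, MeasurableSpace (𝒳 N)] (P : ∀ N, Measure (𝒳 N))
    (D : ℕ → Matrix (Fin p) (Fin p) ℝ) (θ₀ : Θ) (M : ∀ N, MetropolisHastings (𝒳 N) Θ) : Prop :=
  TendstoZeroInProb (ι := ℕ × ℕ) (Ω := fun k => 𝒳 k.1 × (ℕ → Θ)) (atTop ×ˢ atTop)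
    (fun k => P k.1 ⊗ₘ (M k.1).chain)
    (fun k z => blDist (((M k.1).target z.1).map (localCoord (D k.1) θ₀))
      ((empiricalDist k.2 z.2).map (localCoord (D k.1) θ₀)))

/-! ### The limit kernel -/

/-- The data of the limit: densities `π(u | s)` and `q(u, v | s)` with respect to Lebesgue
measure, and acceptance probabilities `A(u, v | s)`. -/
structure LimitModel (S : Type*) [MeasurableSpace S] (p : ℕ) where
  targetDensity : S → EuclideanSpace ℝ (Fin p) → ℝ≥0
  proposalDensity : S → EuclideanSpace ℝ (Fin p) → EuclideanSpace ℝ (Fin p) → ℝ≥0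
  accept : S → EuclideanSpace ℝ (Fin p) → EuclideanSpace ℝ (Fin p) → unitInterval
  measurable_targetDensity :
    Measurable fun z : S × EuclideanSpace ℝ (Fin p) => targetDensity z.1 z.2
  measurable_proposalDensity :
    Measurable fun z : (S × EuclideanSpace ℝ (Fin p)) × EuclideanSpace ℝ (Fin p) =>
      proposalDensity z.1.1 z.1.2 z.2
  measurable_accept :
    Measurable fun z : (S × EuclideanSpace ℝ (Fin p)) × EuclideanSpace ℝ (Fin p) =>
      accept z.1.1 z.1.2 z.2
  lintegral_targetDensity : ∀ s, ∫⁻ u, (targetDensity s u : ℝ≥0∞) = 1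
  lintegral_proposalDensity : ∀ s u, ∫⁻ v, (proposalDensity s u v : ℝ≥0∞) = 1

namespace LimitModel

variable {S : Type*} [MeasurableSpace S] {p : ℕ} (L : LimitModel S p)

/-- `Π(du | s) = π(u | s) du`. -/
def target : Kernel S (EuclideanSpace ℝ (Fin p)) :=
  (Kernel.const S volume).withDensity fun s u => (L.targetDensity s u : ℝ≥0∞)

/-- `Q(u, dv | s) = q(u, v | s) dv`. -/
def proposal : Kernel (S × EuclideanSpace ℝ (Fin p)) (EuclideanSpace ℝ (Fin p)) :=
  (Kernel.const _ volume).withDensity fun z v => (L.proposalDensity z.1 z.2 v : ℝ≥0∞)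

instance : IsMarkovKernel L.target := by
  refine ⟨fun s => ⟨?_⟩⟩
  rw [target, Kernel.withDensity_apply' _ (by
    exact measurable_coe_nnreal_ennreal.comp L.measurable_targetDensity)]
  simpa using L.lintegral_targetDensity s

instance : IsMarkovKernel L.proposal := by
  refine ⟨fun z => ⟨?_⟩⟩
  rw [proposal, Kernel.withDensity_apply' _ (by
    exact measurable_coe_nnreal_ennreal.comp L.measurable_proposalDensity)]
  simpa using L.lintegral_proposalDensity z.1 z.2

/-- `P(u, dv | s) = Q(u, dv | s) A(u, v | s) + R(u | s) δ_u(dv)`. -/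
def kernel : Kernel (S × EuclideanSpace ℝ (Fin p)) (EuclideanSpace ℝ (Fin p)) :=
  metropolisKernel L.proposal L.accept

/-- Regularity of the limit kernel: `π(u | s)`, `q(u, v | s)`, `A(u, v | s)` are continuous
in `s`, and `π(u | s) + q(u, v | s)` is bounded uniformly in `u, v` and in `s ∈ K`, for every
compact `K`. -/
structure IsRegular [TopologicalSpace S] : Prop where
  continuous_targetDensity : ∀ u, Continuous fun s => L.targetDensity s u
  continuous_proposalDensity : ∀ u v, Continuous fun s => L.proposalDensity s u v
  continuous_accept : ∀ u v, Continuous fun s => L.accept s u v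
  bounded : ∀ K : Set S, IsCompact K →
    ∃ C : ℝ≥0, ∀ s ∈ K, ∀ u v, L.targetDensity s u + L.proposalDensity s u v ≤ C

end LimitModel

/-- `κ` is ergodic with invariant measure `μ`: it is `φ`-irreducible for some nonzero `σ`-finite
`φ`, recurrent (from every starting point, the expected number of visits to every set charged by
an irreducibility measure is infinite), and `μ` is invariant. For a probability measure `μ` this
says that `κ` is irreducible and positive recurrent, with invariant law `μ`. -/
structure IsErgodicKernel {E : Type*} [MeasurableSpace E] (κ : Kernel E E) (μ : Measure E) :
    Prop where
  irreducible : ∃ φ : Measure E, SigmaFinite φ ∧ φ ≠ 0 ∧ Kernel.IsIrreducible φ κ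
  recurrent : ∀ φ : Measure E, SigmaFinite φ → Kernel.IsIrreducible φ κ →
    ∀ B, MeasurableSet B → 0 < φ B → ∀ x, ∑' n : ℕ, (κ ^ n) x B = ∞
  invariant : Kernel.Invariant κ μ

end

/-!
For an irreducible kernel `κ` with invariant law `μ` the mean ergodic theorem in `L²(μ)` shows that
the ergodic averages `k⁻¹ (f + κ f + ⋯ + κ^(k-1) f)` of a bounded centred `f` tend to `0` in
`L¹(μ)`. The size of this average at a fixed `k` bounds the second moment of the time averages of
`f` along any stationary chain with kernel `κ`, up to a term `k / m` for `m` steps. As it involves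
only finitely many steps, it changes little when `(κ, μ)` is replaced by a nearby pair: a chain with
a kernel that is close to `κ` inherits the ergodicity of `κ` although nothing is known about its own
mixing. In local coordinates the Metropolis–Hastings kernels are close to the limit kernel at `s_N`
with high probability.

The bounded Lipschitz distance is dominated by the differences of the masses of the sets of a
countable partition into small sets, of which finitely many carry nearly all the mass. Scheffé's
lemma makes the limit model continuous in `s`, so that all this is uniform in a neighbourhood of
every parameter, hence on compact sets, and tightness confines `s_N` to a compact set.
-/

/-! ### Bounded measurable functions and the action of Markov kernels -/

/-- `f` is measurable and bounded by `c` in absolute value. Fixing the bound makes integrability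
automatic and lets the estimates below be tracked quantitatively. -/
def BddMeasurable {T : Type*} [MeasurableSpace T] (c : ℝ) (f : T → ℝ) : Prop :=
  Measurable f ∧ ∀ x, |f x| ≤ c

/-- The action `u ↦ ∫ f(v) κ(u, dv)` of a kernel on functions. -/
noncomputable def kernelAct {T : Type*} [MeasurableSpace T] (κ : Kernel T T) (f : T → ℝ) (u : T) :
    ℝ :=
  ∫ v, f v ∂κ u

/-- The sum `f + κ f + ⋯ + κ^(k-1) f` of the first `k` iterates. -/
noncomputable def kernelSum {T : Type*} [MeasurableSpace T] (κ : Kernel T T) (k : ℕ) (f : T → ℝ)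
    (u : T) : ℝ :=
  ∑ j ∈ Finset.range k, (kernelAct κ)^[j] f u

/-- The `L¹(μ)`-norm of the ergodic average `k⁻¹ (f + κ f + ⋯ + κ^(k-1) f)`. For `f` of mean `0`
it measures how far `κ` is from having averaged `f` out after `k` steps. -/
noncomputable def ergodicDefect {T : Type*} [MeasurableSpace T] (κ : Kernel T T) (μ : Measure T)
    (k : ℕ) (f : T → ℝ) : ℝ :=
  (∫ u, |kernelSum κ k f u| ∂μ) / k

section KernelAct

variable {T : Type*} [MeasurableSpace T] {κ : Kernel T T} {f g : T → ℝ} {c c' : ℝ} {μ : Measure T}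

namespace BddMeasurable

theorem const (a : ℝ) : BddMeasurable |a| fun _ : T => a := ⟨measurable_const, fun _ => le_rfl⟩

theorem integrable (hf : BddMeasurable c f) (μ : Measure T) [IsFiniteMeasure μ] :
    Integrable f μ :=
  Integrable.of_bound hf.1.aestronglyMeasurable c (ae_of_all _ hf.2)

theorem abs_integral_le (hf : BddMeasurable c f) [IsProbabilityMeasure μ] :
    |∫ x, f x ∂μ| ≤ c := by
  simpa using norm_integral_le_of_norm_le_const (μ := μ) (f := f) (ae_of_all _ hf.2)

theorem comp {T' : Type*} [MeasurableSpace T'] (hf : BddMeasurable c f) {l : T' → T}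
    (hl : Measurable l) : BddMeasurable c fun x => f (l x) :=
  ⟨hf.1.comp hl, fun _ => hf.2 _⟩

theorem add (hf : BddMeasurable c f) (hg : BddMeasurable c' g) :
    BddMeasurable (c + c') fun x => f x + g x :=
  ⟨hf.1.add hg.1, fun x => (abs_add_le _ _).trans (add_le_add (hf.2 x) (hg.2 x))⟩

theorem sub (hf : BddMeasurable c f) (hg : BddMeasurable c' g) :
    BddMeasurable (c + c') fun x => f x - g x :=
  ⟨hf.1.sub hg.1, fun x => (abs_sub _ _).trans (add_le_add (hf.2 x) (hg.2 x))⟩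

theorem mul (hf : BddMeasurable c f) (hg : BddMeasurable c' g) :
    BddMeasurable (c * c') fun x => f x * g x := by
  refine ⟨hf.1.mul hg.1, fun x => ?_⟩
  rw [abs_mul]
  exact mul_le_mul (hf.2 x) (hg.2 x) (abs_nonneg _) ((abs_nonneg _).trans (hf.2 x))

theorem abs (hf : BddMeasurable c f) : BddMeasurable c fun x => |f x| :=
  ⟨hf.1.abs, fun x => (abs_abs _).trans_le (hf.2 x)⟩

theorem sum {ι : Type*} (s : Finset ι) {f : ι → T → ℝ} {c : ι → ℝ}
    (hf : ∀ i ∈ s, BddMeasurable (c i) (f i)) :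
    BddMeasurable (∑ i ∈ s, c i) fun x => ∑ i ∈ s, f i x :=
  ⟨Finset.measurable_fun_sum _ fun i hi => (hf i hi).1,
    fun x => (Finset.abs_sum_le_sum_abs _ _).trans (Finset.sum_le_sum fun i hi => (hf i hi).2 x)⟩

theorem act [IsMarkovKernel κ] (hf : BddMeasurable c f) : BddMeasurable c (kernelAct κ f) :=
  ⟨(hf.1.stronglyMeasurable.integral_kernel (κ := κ)).measurable, fun _ => hf.abs_integral_le⟩

theorem iterate [IsMarkovKernel κ] (hf : BddMeasurable c f) (j : ℕ) :
    BddMeasurable c ((kernelAct κ)^[j] f) := by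
  induction j with
  | zero => exact hf
  | succ j ih => rw [Function.iterate_succ_apply']; exact ih.act

theorem kernelSum [IsMarkovKernel κ] (hf : BddMeasurable c f) (k : ℕ) :
    BddMeasurable (k * c) (kernelSum κ k f) := by
  have := BddMeasurable.sum (Finset.range k) fun j _ => hf.iterate (κ := κ) j
  rwa [Finset.sum_const, Finset.card_range, nsmul_eq_mul] at this

end BddMeasurable

theorem kernelAct_sub [IsMarkovKernel κ] (hf : BddMeasurable c f) (hg : BddMeasurable c' g) :
    kernelAct κ (fun x => f x - g x) = fun x => kernelAct κ f x - kernelAct κ g x :=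
  funext fun _ => integral_sub (hf.integrable _) (hg.integrable _)

theorem kernelAct_const [IsMarkovKernel κ] (a : ℝ) :
    kernelAct κ (fun _ => a) = fun _ => a := by
  funext x
  simp [kernelAct]

theorem iterate_kernelAct_sub_const [IsMarkovKernel κ] (hf : BddMeasurable c f) (a : ℝ) (j : ℕ) :
    (kernelAct κ)^[j] (fun x => f x - a) = fun x => (kernelAct κ)^[j] f x - a := by
  induction j with
  | zero => rfl
  | succ j ih =>
    simp only [Function.iterate_succ_apply', ih, kernelAct_sub (hf.iterate j) (.const a),
      kernelAct_const]

theorem kernelAct_kernelSum [IsMarkovKernel κ] (hf : BddMeasurable c f) (k : ℕ) :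
    kernelAct κ (kernelSum κ k f) = kernelSum κ k (kernelAct κ f) := by
  funext x
  simp only [kernelSum, ← Function.iterate_succ_apply, Function.iterate_succ_apply']
  exact integral_finsetSum _ fun j _ => (hf.iterate j).integrable _

theorem iterate_kernelAct_kernelSum [IsMarkovKernel κ] (hf : BddMeasurable c f) (i k : ℕ) :
    (kernelAct κ)^[i] (kernelSum κ k f) = kernelSum κ k ((kernelAct κ)^[i] f) := by
  induction i with
  | zero => rfl
  | succ i ih =>
    rw [Function.iterate_succ_apply', ih, kernelAct_kernelSum (hf.iterate i),
      Function.iterate_succ_apply']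

theorem kernelSum_add [IsMarkovKernel κ] (hf : BddMeasurable c f) (m k : ℕ) :
    kernelSum κ (m + k) f =
      fun x => kernelSum κ m f x + (kernelAct κ)^[m] (kernelSum κ k f) x := by
  funext x
  rw [iterate_kernelAct_kernelSum hf, kernelSum, Finset.sum_range_add]
  simp only [kernelSum, ← Function.iterate_add_apply, Nat.add_comm m]

theorem integral_kernelAct [IsMarkovKernel κ] [IsFiniteMeasure μ] (h : Kernel.Invariant κ μ)
    (hf : BddMeasurable c f) : ∫ x, kernelAct κ f x ∂μ = ∫ x, f x ∂μ := by
  have h_snd : (μ ⊗ₘ κ).map Prod.snd = μ := (Measure.snd_compProd μ κ).trans h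
  calc ∫ x, kernelAct κ f x ∂μ = ∫ z, f z.2 ∂(μ ⊗ₘ κ) :=
        (Measure.integral_compProd ((hf.comp measurable_snd).integrable _)).symm
    _ = ∫ x, f x ∂(μ ⊗ₘ κ).map Prod.snd :=
        (integral_map measurable_snd.aemeasurable hf.1.aestronglyMeasurable).symm
    _ = ∫ x, f x ∂μ := by rw [h_snd]

theorem integral_abs_kernelAct_le [IsMarkovKernel κ] [IsFiniteMeasure μ]
    (h : Kernel.Invariant κ μ) (hf : BddMeasurable c f) :
    ∫ x, |kernelAct κ f x| ∂μ ≤ ∫ x, |f x| ∂μ := by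
  rw [← integral_kernelAct h hf.abs]
  exact integral_mono (hf.act.abs.integrable _) (hf.abs.act.integrable _) fun x =>
    abs_integral_le_integral_abs

theorem integral_abs_iterate_kernelAct_le [IsMarkovKernel κ] [IsFiniteMeasure μ]
    (h : Kernel.Invariant κ μ) (hf : BddMeasurable c f) (j : ℕ) :
    ∫ x, |(kernelAct κ)^[j] f x| ∂μ ≤ ∫ x, |f x| ∂μ := by
  induction j with
  | zero => exact le_rfl
  | succ j ih =>
    rw [Function.iterate_succ_apply']
    exact (integral_abs_kernelAct_le h (hf.iterate j)).trans ih

theorem subadditive_integral_abs_kernelSum [IsMarkovKernel κ] [IsFiniteMeasure μ]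
    (h : Kernel.Invariant κ μ) (hf : BddMeasurable c f) :
    Subadditive fun n => ∫ x, |kernelSum κ n f x| ∂μ := by
  intro m k
  have hm := hf.kernelSum (κ := κ) m
  have hk := (hf.kernelSum (κ := κ) k).iterate (κ := κ) m
  calc ∫ x, |kernelSum κ (m + k) f x| ∂μ
      ≤ ∫ x, (|kernelSum κ m f x| + |(kernelAct κ)^[m] (kernelSum κ k f) x|) ∂μ := by
        rw [kernelSum_add hf]
        exact integral_mono ((hm.add hk).abs.integrable _) ((hm.abs.add hk.abs).integrable _)
          fun x => abs_add_le _ _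
    _ = ∫ x, |kernelSum κ m f x| ∂μ + ∫ x, |(kernelAct κ)^[m] (kernelSum κ k f) x| ∂μ :=
        integral_add (hm.abs.integrable _) (hk.abs.integrable _)
    _ ≤ ∫ x, |kernelSum κ m f x| ∂μ + ∫ x, |kernelSum κ k f x| ∂μ :=
        add_le_add_right (integral_abs_iterate_kernelAct_le h (hf.kernelSum k) m) _

theorem integral_abs_kernelSum_le [IsMarkovKernel κ] [IsProbabilityMeasure μ]
    (hf : BddMeasurable c f) (n : ℕ) : ∫ x, |kernelSum κ n f x| ∂μ ≤ n * c :=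
  (le_abs_self _).trans (hf.kernelSum (κ := κ) n).abs.abs_integral_le

theorem ergodicDefect_nonneg (k : ℕ) : 0 ≤ ergodicDefect κ μ k f := by
  unfold ergodicDefect
  positivity

theorem integral_abs_kernelSum_le_ergodicDefect [IsMarkovKernel κ] [IsProbabilityMeasure μ]
    (h : Kernel.Invariant κ μ) (hf : BddMeasurable c f) {k : ℕ} (hk : 0 < k) (n : ℕ) :
    ∫ x, |kernelSum κ n f x| ∂μ ≤ n * ergodicDefect κ μ k f + k * c := by
  obtain ⟨x⟩ := nonempty_of_isProbabilityMeasure μ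
  have hc : 0 ≤ c := (abs_nonneg _).trans (hf.2 x)
  have h_quot : ((n / k : ℕ) : ℝ) ≤ n / k := Nat.cast_div_le
  have h_rem : ((n % k : ℕ) : ℝ) ≤ k := by exact_mod_cast (Nat.mod_lt n hk).le
  calc ∫ x, |kernelSum κ n f x| ∂μ = ∫ x, |kernelSum κ (n / k * k + n % k) f x| ∂μ := by
        rw [Nat.div_add_mod']
    _ ≤ (n / k : ℕ) * ∫ x, |kernelSum κ k f x| ∂μ + ∫ x, |kernelSum κ (n % k) f x| ∂μ :=
        (subadditive_integral_abs_kernelSum h hf).apply_mul_add_le ..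
    _ ≤ (n / k : ℝ) * ∫ x, |kernelSum κ k f x| ∂μ + k * c := by
        gcongr
        exact (integral_abs_kernelSum_le (κ := κ) hf _).trans (by gcongr)
    _ = n * ergodicDefect κ μ k f + k * c := by rw [ergodicDefect]; ring

end KernelAct

/-! ### Ergodic averages and empirical distributions of stationary chains -/

/-- Up to its marginals at two times, the law `ρ` on path space is that of a stationary Markov chain
with transition kernel `κ` and one-time law `μ`: the condition tests the identity
`ρ(θ_i ∈ du, θ_{i+j} ∈ dv) = μ(du) κ^j(u, dv)` on bounded functions. Second moments of time averages
involve no other marginals. -/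
def IsStationaryChain {T : Type*} [MeasurableSpace T] (κ : Kernel T T) (μ : Measure T)
    (ρ : Measure (ℕ → T)) : Prop :=
  ∀ ⦃f g : T → ℝ⦄ ⦃c c' : ℝ⦄, BddMeasurable c f → BddMeasurable c' g → ∀ i j,
    ∫ θ, f (θ i) * g (θ (i + j)) ∂ρ = ∫ u, f u * (kernelAct κ)^[j] g u ∂μ

/-- The function `1_B - μ(B)`. Its time averages along a chain are the errors of the empirical
frequencies of `B`. -/
noncomputable def centeredIndicator {T : Type*} [MeasurableSpace T] (μ : Measure T) (B : Set T)
    (u : T) : ℝ :=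
  B.indicator 1 u - μ.real B

section SecondMoment

theorem sq_sum_range_le (x : ℕ → ℝ) (n : ℕ) :
    (∑ i ∈ Finset.range n, x i) ^ 2 ≤
      2 * ∑ i ∈ Finset.range n, ∑ j ∈ Finset.Ico i n, x i * x j := by
  induction n with
  | zero => simp
  | succ n ih =>
    have h_split : ∑ i ∈ Finset.range n, ∑ j ∈ Finset.Ico i (n + 1), x i * x j =
        ∑ i ∈ Finset.range n, ∑ j ∈ Finset.Ico i n, x i * x j
          + (∑ i ∈ Finset.range n, x i) * x n := by
      rw [Finset.sum_mul, ← Finset.sum_add_distrib]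
      refine Finset.sum_congr rfl fun i hi => ?_
      rw [Finset.sum_Ico_succ_top (Finset.mem_range.1 hi).le]
    simp only [Finset.sum_range_succ, h_split, Nat.Ico_succ_singleton, Finset.sum_singleton]
    nlinarith [sq_nonneg (x n)]

theorem integral_sq_sum_range_le {Ω : Type*} [MeasurableSpace Ω] {ρ : Measure Ω}
    [IsFiniteMeasure ρ] {X : ℕ → Ω → ℝ} {c : ℝ} (hX : ∀ i, BddMeasurable c (X i)) (n : ℕ) :
    ∫ ω, (∑ i ∈ Finset.range n, X i ω) ^ 2 ∂ρ ≤
      2 * ∑ i ∈ Finset.range n, ∑ j ∈ Finset.Ico i n, ∫ ω, X i ω * X j ω ∂ρ := by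
  have h_mul (i j) : Integrable (fun ω => X i ω * X j ω) ρ := ((hX i).mul (hX j)).integrable _
  have h_row (i) : Integrable (fun ω => ∑ j ∈ Finset.Ico i n, X i ω * X j ω) ρ :=
    integrable_finsetSum _ fun j _ => h_mul i j
  have h_sum := BddMeasurable.sum (Finset.range n) fun i _ => hX i
  simp only [← integral_finsetSum _ fun j _ => h_mul _ j, ← integral_const_mul,
    ← integral_finsetSum _ fun i _ => h_row i]
  refine integral_mono ?_ ((integrable_finsetSum _ fun i _ => h_row i).const_mul 2) fun ω =>
    sq_sum_range_le (X · ω) n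
  simpa only [sq] using (h_sum.mul h_sum).integrable ρ

theorem BddMeasurable.memLp {T : Type*} [MeasurableSpace T] {μ : Measure T} [IsFiniteMeasure μ]
    {f : T → ℝ} {c : ℝ} (hf : BddMeasurable c f) : MemLp f 2 μ :=
  MemLp.of_bound hf.1.aestronglyMeasurable c (ae_of_all _ hf.2)

theorem integral_abs_le_sqrt_integral_sq {Ω : Type*} [MeasurableSpace Ω] {ρ : Measure Ω}
    [IsProbabilityMeasure ρ] {f : Ω → ℝ} (hf : MemLp f 2 ρ) :
    ∫ ω, |f ω| ∂ρ ≤ √(∫ ω, f ω ^ 2 ∂ρ) := by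
  have h_var := variance_nonneg |f| ρ
  rw [variance_eq_sub hf.abs] at h_var
  simp only [Pi.pow_apply, Pi.abs_apply, sq_abs] at h_var
  exact Real.le_sqrt_of_sq_le (by linarith)

end SecondMoment

section StationaryChain

variable {T : Type*} [MeasurableSpace T] {κ : Kernel T T} {μ : Measure T} {ρ : Measure (ℕ → T)}
  {g : T → ℝ} {B : Set T} {m : ℕ}

namespace IsStationaryChain

theorem integral_eq (hρ : IsStationaryChain κ μ ρ) {c : ℝ} (hg : BddMeasurable c g) (i : ℕ) :
    ∫ θ, g (θ i) ∂ρ = ∫ u, g u ∂μ := by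
  simpa using hρ (.const 1) hg i 0

theorem sum_Ico_integral_mul [IsMarkovKernel κ] [IsFiniteMeasure μ]
    (hρ : IsStationaryChain κ μ ρ) {c : ℝ} (hg : BddMeasurable c g) (i n : ℕ) :
    ∑ j ∈ Finset.Ico i n, ∫ θ, g (θ i) * g (θ j) ∂ρ =
      ∫ u, g u * kernelSum κ (n - i) g u ∂μ := by
  rw [Finset.sum_Ico_eq_sum_range]
  simp only [hρ hg hg, kernelSum, Finset.mul_sum]
  exact (integral_finsetSum _ fun j _ => (hg.mul (hg.iterate j)).integrable _).symm

variable [IsMarkovKernel κ] [IsProbabilityMeasure μ] [IsProbabilityMeasure ρ]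

theorem integral_sq_sum_le (hρ : IsStationaryChain κ μ ρ) (h : Kernel.Invariant κ μ)
    (hg : BddMeasurable 1 g) {k : ℕ} (hk : 0 < k) (m : ℕ) :
    ∫ θ, (∑ i ∈ Finset.range m, g (θ i)) ^ 2 ∂ρ ≤ 2 * (m * (m * ergodicDefect κ μ k g + k)) := by
  have h_row (n : ℕ) (hn : n ≤ m) :
      ∫ u, g u * kernelSum κ n g u ∂μ ≤ m * ergodicDefect κ μ k g + k := by
    have hs := hg.kernelSum (κ := κ) n
    calc ∫ u, g u * kernelSum κ n g u ∂μ ≤ ∫ u, |kernelSum κ n g u| ∂μ := by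
          refine integral_mono ((hg.mul hs).integrable _) (hs.abs.integrable _) fun u => ?_
          refine (le_abs_self _).trans ?_
          rw [abs_mul]
          exact mul_le_of_le_one_left (abs_nonneg _) (hg.2 u)
      _ ≤ n * ergodicDefect κ μ k g + k * 1 := integral_abs_kernelSum_le_ergodicDefect h hg hk n
      _ ≤ m * ergodicDefect κ μ k g + k := by
          rw [mul_one]
          gcongr
          exact ergodicDefect_nonneg k
  calc ∫ θ, (∑ i ∈ Finset.range m, g (θ i)) ^ 2 ∂ρ
      ≤ 2 * ∑ i ∈ Finset.range m, ∑ j ∈ Finset.Ico i m, ∫ θ, g (θ i) * g (θ j) ∂ρ :=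
        integral_sq_sum_range_le (fun i => hg.comp (measurable_pi_apply i)) m
    _ = 2 * ∑ i ∈ Finset.range m, ∫ u, g u * kernelSum κ (m - i) g u ∂μ := by
        simp only [hρ.sum_Ico_integral_mul hg]
    _ ≤ 2 * ∑ _i ∈ Finset.range m, (m * ergodicDefect κ μ k g + k) := by
        gcongr with i _
        exact h_row _ (Nat.sub_le m i)
    _ = 2 * (m * (m * ergodicDefect κ μ k g + k)) := by
        rw [Finset.sum_const, Finset.card_range, nsmul_eq_mul]

theorem integral_abs_average_le (hρ : IsStationaryChain κ μ ρ) (h : Kernel.Invariant κ μ)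
    (hg : BddMeasurable 1 g) {k : ℕ} (hk : 0 < k) (hm : 0 < m) :
    ∫ θ, |(m : ℝ)⁻¹ * ∑ i ∈ Finset.range m, g (θ i)| ∂ρ ≤
      √(2 * (ergodicDefect κ μ k g + k / m)) := by
  have h_sum : BddMeasurable _ fun θ : ℕ → T => (m : ℝ)⁻¹ * ∑ i ∈ Finset.range m, g (θ i) :=
    (BddMeasurable.const _).mul (.sum _ fun i _ => hg.comp (measurable_pi_apply i))
  refine (integral_abs_le_sqrt_integral_sq h_sum.memLp).trans (Real.sqrt_le_sqrt ?_)
  simp only [mul_pow, integral_const_mul]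
  calc (m : ℝ)⁻¹ ^ 2 * ∫ θ, (∑ i ∈ Finset.range m, g (θ i)) ^ 2 ∂ρ
      ≤ (m : ℝ)⁻¹ ^ 2 * (2 * (m * (m * ergodicDefect κ μ k g + k))) := by
        gcongr
        exact hρ.integral_sq_sum_le h hg hk m
    _ = 2 * (ergodicDefect κ μ k g + k / m) := by
        field_simp

end IsStationaryChain

theorem bddMeasurable_indicator (hB : MeasurableSet B) :
    BddMeasurable 1 (B.indicator (1 : T → ℝ)) := by
  refine ⟨measurable_one.indicator hB, fun u => ?_⟩
  by_cases hu : u ∈ B <;> simp [hu]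

theorem bddMeasurable_centeredIndicator [IsZeroOrProbabilityMeasure μ] (hB : MeasurableSet B) :
    BddMeasurable 1 (centeredIndicator μ B) := by
  refine ⟨(measurable_one.indicator hB).sub_const _, fun u => ?_⟩
  have h0 := measureReal_nonneg (μ := μ) (s := B)
  have h1 := measureReal_le_one (μ := μ) (s := B)
  rw [centeredIndicator, abs_le]
  by_cases hu : u ∈ B <;> simp only [hu, Set.indicator_of_mem, Set.indicator_of_notMem,
    not_false_eq_true, Pi.one_apply] <;> constructor <;> linarith

theorem integral_centeredIndicator [IsProbabilityMeasure μ] (hB : MeasurableSet B) :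
    ∫ u, centeredIndicator μ B u ∂μ = 0 := by
  simp only [centeredIndicator]
  rw [integral_sub ((bddMeasurable_indicator hB).integrable _) (integrable_const _),
    integral_indicator_one hB]
  simp

theorem isProbabilityMeasure_empiricalDist (hm : 0 < m) (θ : ℕ → T) :
    IsProbabilityMeasure (empiricalDist m θ) := by
  constructor
  rw [empiricalDist, Measure.smul_apply, Measure.finsetSum_apply]
  simp only [measure_univ, Finset.sum_const, Finset.card_range, nsmul_eq_mul, mul_one, smul_eq_mul]
  exact ENNReal.inv_mul_cancel (by exact_mod_cast hm.ne') (ENNReal.natCast_ne_top m)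

theorem measureReal_empiricalDist (m : ℕ) (θ : ℕ → T) (hB : MeasurableSet B) :
    (empiricalDist m θ).real B =
      (m : ℝ)⁻¹ * ∑ i ∈ Finset.range m, B.indicator (1 : T → ℝ) (θ i) := by
  simp only [measureReal_def, empiricalDist, Measure.smul_apply, Measure.finsetSum_apply,
    Measure.dirac_apply' _ hB, smul_eq_mul, ENNReal.toReal_mul, ENNReal.toReal_inv,
    ENNReal.toReal_natCast]
  rw [ENNReal.toReal_sum fun i _ => by by_cases h : θ i ∈ B <;> simp [h]]
  congr! 2 with i
  by_cases h : θ i ∈ B <;> simp [h]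

theorem measureReal_empiricalDist_sub (hm : 0 < m) (θ : ℕ → T) (hB : MeasurableSet B) :
    (empiricalDist m θ).real B - μ.real B =
      (m : ℝ)⁻¹ * ∑ i ∈ Finset.range m, centeredIndicator μ B (θ i) := by
  simp only [measureReal_empiricalDist m θ hB, centeredIndicator, Finset.sum_sub_distrib,
    Finset.sum_const, Finset.card_range, nsmul_eq_mul]
  field_simp

theorem bddMeasurable_measureReal_empiricalDist (hm : 0 < m) (hB : MeasurableSet B) :
    BddMeasurable 1 fun θ : ℕ → T => (empiricalDist m θ).real B := by
  refine ⟨?_, fun θ => ?_⟩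
  · simp only [measureReal_empiricalDist m _ hB]
    exact (Finset.measurable_fun_sum _ fun i _ =>
      (measurable_one.indicator hB).comp (measurable_pi_apply i)).const_mul _
  · have := isProbabilityMeasure_empiricalDist hm θ
    rw [abs_of_nonneg measureReal_nonneg]
    exact measureReal_le_one

namespace IsStationaryChain

theorem integral_measureReal_empiricalDist [IsFiniteMeasure ρ] (hρ : IsStationaryChain κ μ ρ)
    (hm : 0 < m) (hB : MeasurableSet B) :
    ∫ θ, (empiricalDist m θ).real B ∂ρ = μ.real B := by
  have hi := bddMeasurable_indicator hB
  simp only [measureReal_empiricalDist m _ hB, integral_const_mul]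
  rw [integral_finsetSum _ fun i _ => (hi.comp (measurable_pi_apply i)).integrable _]
  simp only [hρ.integral_eq hi, integral_indicator_one hB, Finset.sum_const, Finset.card_range,
    nsmul_eq_mul]
  field_simp

variable [IsProbabilityMeasure ρ]

theorem integral_abs_measureReal_sub_le [IsMarkovKernel κ] [IsProbabilityMeasure μ]
    (hρ : IsStationaryChain κ μ ρ) (h : Kernel.Invariant κ μ) (hB : MeasurableSet B) {k : ℕ}
    (hk : 0 < k) (hm : 0 < m) :
    ∫ θ, |μ.real B - (empiricalDist m θ).real B| ∂ρ ≤
      √(2 * (ergodicDefect κ μ k (centeredIndicator μ B) + k / m)) := by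
  simp only [abs_sub_comm (μ.real B), measureReal_empiricalDist_sub hm _ hB]
  exact hρ.integral_abs_average_le h (bddMeasurable_centeredIndicator hB) hk hm

theorem integral_abs_measureReal_sub_le_two_mul (hρ : IsStationaryChain κ μ ρ) (hm : 0 < m)
    (hB : MeasurableSet B) :
    ∫ θ, |μ.real B - (empiricalDist m θ).real B| ∂ρ ≤ 2 * μ.real B := by
  have he := bddMeasurable_measureReal_empiricalDist (T := T) hm hB
  calc ∫ θ, |μ.real B - (empiricalDist m θ).real B| ∂ρ
      ≤ ∫ θ, (μ.real B + (empiricalDist m θ).real B) ∂ρ := by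
        refine integral_mono (((BddMeasurable.const _).sub he).abs.integrable _)
          (((BddMeasurable.const _).add he).integrable _) fun θ => ?_
        refine (abs_sub _ _).trans_eq ?_
        rw [abs_of_nonneg measureReal_nonneg, abs_of_nonneg measureReal_nonneg]
    _ = 2 * μ.real B := by
        rw [integral_add (integrable_const _) (he.integrable _),
          hρ.integral_measureReal_empiricalDist hm hB]
        simp [two_mul]

end IsStationaryChain

end StationaryChain

/-! ### The mean ergodic theorem for irreducible kernels -/

section MeanErgodic

variable {T : Type*} [MeasurableSpace T] {κ : Kernel T T} {μ : Measure T}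

theorem invariant_pow (h : Kernel.Invariant κ μ) (n : ℕ) : Kernel.Invariant (κ ^ n) μ := by
  induction n with
  | zero => exact Measure.id_comp
  | succ n ih => rw [pow_succ']; exact h.comp ih

theorem ae_ae_pow_eq_of_ae_ae_eq (h : Kernel.Invariant κ μ) {f : T → ℝ} (hf : Measurable f)
    (h_fix : ∀ᵐ u ∂μ, ∀ᵐ v ∂κ u, f v = f u) (n : ℕ) :
    ∀ᵐ u ∂μ, ∀ᵐ v ∂(κ ^ n) u, f v = f u := by
  have h_meas (u : T) : MeasurableSet {v | f v = f u} := measurableSet_eq_fun hf measurable_const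
  induction n with
  | zero =>
    refine ae_of_all _ fun u => ?_
    have h_dirac : (κ ^ 0) u = Measure.dirac u := Kernel.id_apply u
    rw [h_dirac, ae_dirac_iff (h_meas u)]
  | succ n ih =>
    have h_fix_pow : ∀ᵐ u ∂μ, ∀ᵐ w ∂(κ ^ n) u, ∀ᵐ v ∂κ w, f v = f w :=
      Measure.ae_ae_of_ae_comp (by rwa [(invariant_pow h n).def])
    filter_upwards [ih, h_fix_pow] with u hu hu_fix
    change ((κ ^ (n + 1)) u) {v | f v = f u}ᶜ = 0
    rw [Kernel.pow_succ_apply_eq_lintegral _ _ _ (h_meas u).compl,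
      lintegral_eq_zero_iff (κ.measurable_coe (h_meas u).compl)]
    filter_upwards [hu, hu_fix] with w hw hw_fix
    rwa [hw] at hw_fix

theorem exists_ae_eq_const_of_isIrreducible [IsProbabilityMeasure μ] (h : Kernel.Invariant κ μ)
    {φ : Measure T} (hφ : φ ≠ 0) (h_irr : Kernel.IsIrreducible φ κ) {f : T → ℝ}
    (hf : Measurable f) (h_fix : ∀ᵐ u ∂μ, ∀ᵐ v ∂κ u, f v = f u) : ∃ a, ∀ᵐ u ∂μ, f u = a := by
  have h_level : ∀ᵐ u ∂μ, ∀ᵐ v ∂φ, f v = f u := by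
    filter_upwards [ae_all_iff.2 (ae_ae_pow_eq_of_ae_ae_eq h hf h_fix)] with u hu
    by_contra h_not
    obtain ⟨n, hn⟩ := h_irr.irreducible
      (measurableSet_eq_fun hf measurable_const).compl (pos_iff_ne_zero.2 h_not) u
    exact hn.ne' (hu n)
  obtain ⟨u₀, hu₀⟩ := h_level.exists
  have : NeBot (ae φ) := ae_neBot.2 hφ
  refine ⟨f u₀, h_level.mono fun u hu => ?_⟩
  obtain ⟨v, hv, hv₀⟩ := (hu.and hu₀).exists
  exact hv.symm.trans hv₀

variable [IsMarkovKernel κ] [IsProbabilityMeasure μ] {f : T → ℝ} {c : ℝ}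

theorem measurePreserving_fst_compProd : MeasurePreserving Prod.fst (μ ⊗ₘ κ) μ :=
  ⟨measurable_fst, Measure.fst_compProd μ κ⟩

theorem measurePreserving_snd_compProd (h : Kernel.Invariant κ μ) :
    MeasurePreserving Prod.snd (μ ⊗ₘ κ) μ :=
  ⟨measurable_snd, (Measure.snd_compProd μ κ).trans h⟩

/-- The extension of `kernelAct κ` to `L²(μ)`, for an invariant probability measure `μ`. It is
built as `V* U` from the isometric embeddings `V x (u, v) = x u` and `U x (u, v) = x v` of `L²(μ)`
into `L²(μ ⊗ₘ κ)`, which makes it a contraction. -/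
noncomputable def markovL2 (h : Kernel.Invariant κ μ) : Lp ℝ 2 μ →L[ℝ] Lp ℝ 2 μ :=
  (Lp.compMeasurePreservingₗᵢ ℝ Prod.fst
      (measurePreserving_fst_compProd (κ := κ))).toContinuousLinearMap.adjoint ∘L
    (Lp.compMeasurePreservingₗᵢ ℝ Prod.snd
      (measurePreserving_snd_compProd h)).toContinuousLinearMap

theorem norm_markovL2_le (h : Kernel.Invariant κ μ) : ‖markovL2 h‖ ≤ 1 := by
  refine (ContinuousLinearMap.opNorm_comp_le _ _).trans ?_
  rw [LinearIsometryEquiv.norm_map]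
  exact mul_le_one₀ (LinearIsometry.norm_toContinuousLinearMap_le _) (norm_nonneg _)
    (LinearIsometry.norm_toContinuousLinearMap_le _)

theorem inner_markovL2 (h : Kernel.Invariant κ μ) (x y : Lp ℝ 2 μ) :
    inner ℝ x (markovL2 h y) =
      inner ℝ (Lp.compMeasurePreservingₗᵢ ℝ Prod.fst (measurePreserving_fst_compProd (κ := κ)) x)
        (Lp.compMeasurePreservingₗᵢ ℝ Prod.snd (measurePreserving_snd_compProd h) y) := by
  rw [markovL2, ContinuousLinearMap.comp_apply, ContinuousLinearMap.adjoint_inner_right]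
  rfl

theorem inner_markovL2_eq_integral (h : Kernel.Invariant κ μ) (x y : Lp ℝ 2 μ) :
    inner ℝ x (markovL2 h y) = ∫ z, x z.1 * y z.2 ∂(μ ⊗ₘ κ) := by
  rw [inner_markovL2, L2.inner_def]
  refine integral_congr_ae ?_
  filter_upwards [Lp.coeFn_compMeasurePreserving x (measurePreserving_fst_compProd (κ := κ)),
    Lp.coeFn_compMeasurePreserving y (measurePreserving_snd_compProd h)] with z hx hy
  change inner ℝ (Lp.compMeasurePreserving Prod.fst _ x z)
    (Lp.compMeasurePreserving Prod.snd _ y z) = _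
  rw [hx, hy]
  exact mul_comm _ _

theorem markovL2_toLp (h : Kernel.Invariant κ μ) (hf : BddMeasurable c f) :
    markovL2 h (hf.memLp.toLp f) = hf.act.memLp.toLp (kernelAct κ f) := by
  refine ext_inner_left ℝ fun x => ?_
  have h_int : Integrable (fun z => x z.1 * f z.2) (μ ⊗ₘ κ) :=
    MemLp.integrable_mul
      ((Lp.memLp x).comp_measurePreserving (measurePreserving_fst_compProd (κ := κ)))
      (hf.comp measurable_snd).memLp
  have h_snd := (measurePreserving_snd_compProd h).quasiMeasurePreserving.ae_eq_comp
    hf.memLp.coeFn_toLp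
  calc inner ℝ x (markovL2 h (hf.memLp.toLp f)) = ∫ z, x z.1 * f z.2 ∂(μ ⊗ₘ κ) := by
        rw [inner_markovL2_eq_integral]
        exact integral_congr_ae (h_snd.mono fun z hz => congrArg (x z.1 * ·) hz)
    _ = ∫ u, x u * kernelAct κ f u ∂μ := by
        simp only [Measure.integral_compProd h_int, integral_const_mul, kernelAct]
    _ = inner ℝ x (hf.act.memLp.toLp (kernelAct κ f)) := by
        rw [L2.inner_def]
        refine integral_congr_ae ((hf.act (κ := κ)).memLp.coeFn_toLp.mono fun u hu => ?_)
        simp only [hu, RCLike.inner_apply, conj_trivial, mul_comm]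

theorem iterate_markovL2_toLp (h : Kernel.Invariant κ μ) (hf : BddMeasurable c f) (j : ℕ) :
    (markovL2 h)^[j] (hf.memLp.toLp f) = (hf.iterate j).memLp.toLp ((kernelAct κ)^[j] f) := by
  induction j with
  | zero => rfl
  | succ j ih =>
    rw [Function.iterate_succ_apply', ih, markovL2_toLp h (hf.iterate j)]
    simp only [Function.iterate_succ_apply']

theorem birkhoffSum_markovL2_toLp (h : Kernel.Invariant κ μ) (hf : BddMeasurable c f) (k : ℕ) :
    birkhoffSum (markovL2 h) _root_.id k (hf.memLp.toLp f) =
      (hf.kernelSum k).memLp.toLp (kernelSum κ k f) := by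
  induction k with
  | zero =>
    have h_zero : kernelSum κ 0 f = 0 := by funext; simp [kernelSum]
    simp only [birkhoffSum_zero, h_zero, MemLp.toLp_zero]
  | succ k ih =>
    rw [birkhoffSum_succ, ih, id, iterate_markovL2_toLp h hf, ← MemLp.toLp_add]
    congr 1
    funext u
    exact (Finset.sum_range_succ (fun j => (kernelAct κ)^[j] f u) k).symm

theorem integral_abs_le_norm_toLp (hf : MemLp f 2 μ) : ∫ u, |f u| ∂μ ≤ ‖hf.toLp f‖ := by
  simp only [← Real.norm_eq_abs]
  rw [integral_norm_eq_lintegral_enorm hf.1, Lp.norm_toLp, ← eLpNorm_one_eq_lintegral_enorm]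
  exact ENNReal.toReal_mono hf.2.ne (eLpNorm_le_eLpNorm_of_exponent_le one_le_two hf.1)

theorem ergodicDefect_le_norm_birkhoffAverage (h : Kernel.Invariant κ μ)
    (hf : BddMeasurable c f) (k : ℕ) :
    ergodicDefect κ μ k f ≤
      ‖birkhoffAverage ℝ (markovL2 h) _root_.id k (hf.memLp.toLp f)‖ := by
  rw [birkhoffAverage, birkhoffSum_markovL2_toLp h hf, norm_smul, ergodicDefect, norm_inv,
    RCLike.norm_natCast, div_eq_inv_mul]
  gcongr
  exact integral_abs_le_norm_toLp _

/-- Equality in the Cauchy–Schwarz inequality `⟪V x, U x⟫ ≤ ‖V x‖ ‖U x‖` forces `V x = U x`. -/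
theorem ae_ae_eq_of_markovL2_eq (h : Kernel.Invariant κ μ) {x : Lp ℝ 2 μ}
    (hx : markovL2 h x = x) : ∀ᵐ u ∂μ, ∀ᵐ v ∂κ u, x v = x u := by
  set U := Lp.compMeasurePreservingₗᵢ (E := ℝ) (p := 2) ℝ Prod.snd
    (measurePreserving_snd_compProd h)
  set V := Lp.compMeasurePreservingₗᵢ (E := ℝ) (p := 2) ℝ Prod.fst
    (measurePreserving_fst_compProd (κ := κ) (μ := μ))
  have h_eq : V x = U x := by
    refine eq_of_norm_le_re_inner_eq_norm_sq (𝕜 := ℝ) ?_ ?_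
    · rw [LinearIsometry.norm_map, LinearIsometry.norm_map]
    · rw [← inner_markovL2 h, hx, LinearIsometry.norm_map, inner_self_eq_norm_sq]
  have hU : U x =ᵐ[μ ⊗ₘ κ] x ∘ Prod.snd := Lp.coeFn_compMeasurePreserving _ _
  have hV : V x =ᵐ[μ ⊗ₘ κ] x ∘ Prod.fst := Lp.coeFn_compMeasurePreserving _ _
  refine Measure.ae_ae_of_ae_compProd (p := fun z => x z.2 = x z.1) ?_
  filter_upwards [hU, hV] with z hUz hVz
  rw [h_eq] at hVz
  exact hUz.symm.trans hVz

theorem tendsto_ergodicDefect (h : Kernel.Invariant κ μ) {φ : Measure T} (hφ : φ ≠ 0)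
    (h_irr : Kernel.IsIrreducible φ κ) (hf : BddMeasurable c f) (hf0 : ∫ u, f u ∂μ = 0) :
    Tendsto (fun k => ergodicDefect κ μ k f) atTop (𝓝 0) := by
  have h_mean := ContinuousLinearMap.tendsto_birkhoffAverage_orthogonalProjection (markovL2 h)
    (norm_markovL2_le h) (hf.memLp.toLp f)
  have h_proj : ((markovL2 h).eqLocus (1 : Lp ℝ 2 μ →L[ℝ] Lp ℝ 2 μ)).orthogonalProjectionOnto
      (hf.memLp.toLp f) = 0 := by
    rw [Submodule.orthogonalProjectionOnto_eq_zero_iff]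
    intro x hx
    obtain ⟨a, ha⟩ := exists_ae_eq_const_of_isIrreducible h hφ h_irr
      (Lp.stronglyMeasurable x).measurable (ae_ae_eq_of_markovL2_eq h hx)
    have h_inner : ∀ᵐ u ∂μ, inner ℝ (x u) ((hf.memLp (μ := μ)).toLp f u) = a * f u := by
      filter_upwards [ha, hf.memLp.coeFn_toLp] with u hxu hfu
      rw [hxu, hfu, real_inner_comm, RCLike.inner_apply, conj_trivial]
    rw [L2.inner_def, integral_congr_ae h_inner, integral_const_mul, hf0, mul_zero]
  refine squeeze_zero ergodicDefect_nonneg (ergodicDefect_le_norm_birkhoffAverage h hf) ?_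
  simpa only [h_proj, ZeroMemClass.coe_zero, norm_zero] using h_mean.norm

end MeanErgodic

/-! ### Trajectories of a stationary Markov chain -/

section MarkovChain

variable {T : Type*} [MeasurableSpace T] (κ : Kernel T T) [IsMarkovKernel κ] (μ : Measure T)

/-- The law on `ℕ → T` of the time-homogeneous Markov chain with initial law `μ` and transition
kernel `κ`. -/
noncomputable def markovChainLaw : Measure (ℕ → T) :=
  Kernel.trajMeasure (X := fun _ : ℕ => T) μ
    fun n => κ.comap (fun h => h ⟨n, Finset.mem_Iic.2 le_rfl⟩) (measurable_pi_apply _)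

instance [IsProbabilityMeasure μ] : IsProbabilityMeasure (markovChainLaw κ μ) := by
  unfold markovChainLaw
  infer_instance

theorem markovChainLaw_map_zero : (markovChainLaw κ μ).map (fun θ => θ 0) = μ := by
  have h_eval : Measurable fun z : Finset.Iic 0 → T => z ⟨0, Finset.mem_Iic.2 le_rfl⟩ :=
    measurable_pi_apply _
  have h_zero : (fun θ : ℕ → T => θ 0) =
      (fun z : Finset.Iic 0 → T => z ⟨0, Finset.mem_Iic.2 le_rfl⟩) ∘
        Preorder.frestrictLe 0 := rfl
  rw [h_zero, ← Measure.map_map h_eval (by fun_prop), markovChainLaw, Kernel.trajMeasure,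
    Measure.map_comp _ _ (by fun_prop), Kernel.traj_map_frestrictLe, Kernel.partialTraj_self,
    Measure.id_comp, Measure.map_map h_eval (by fun_prop)]
  exact Measure.map_id

variable {κ μ} [IsProbabilityMeasure μ] {f g : T → ℝ} {c c' : ℝ}

theorem integral_mul_succ_markovChainLaw (hf : BddMeasurable c f) (hg : BddMeasurable c' g)
    {i n : ℕ} (hi : i ≤ n) :
    ∫ θ, f (θ i) * g (θ (n + 1)) ∂markovChainLaw κ μ =
      ∫ θ, f (θ i) * kernelAct κ g (θ n) ∂markovChainLaw κ μ := by
  set past : (ℕ → T) → Finset.Iic n → T := Preorder.frestrictLe (π := fun _ => T) n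
  have h_step : (markovChainLaw κ μ).map past ⊗ₘ
      κ.comap (fun h => h ⟨n, Finset.mem_Iic.2 le_rfl⟩) (measurable_pi_apply _) =
        (markovChainLaw κ μ).map fun θ => (past θ, θ (n + 1)) :=
    Kernel.map_frestrictLe_trajMeasure_compProd_eq_map_trajMeasure (X := fun _ : ℕ => T)
  have h_past : Measurable past := by fun_prop
  have h_pair : Measurable fun θ : ℕ → T => (past θ, θ (n + 1)) := by fun_prop
  have h_coord (k : Finset.Iic n) : Measurable fun z : Finset.Iic n → T => z k :=
    measurable_pi_apply k
  have hF : BddMeasurable (c * c') fun z : (Finset.Iic n → T) × T =>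
      f (z.1 ⟨i, Finset.mem_Iic.2 hi⟩) * g z.2 :=
    (hf.comp ((h_coord _).comp measurable_fst)).mul (hg.comp measurable_snd)
  have hG : BddMeasurable (c * c') fun z : Finset.Iic n → T =>
      f (z ⟨i, Finset.mem_Iic.2 hi⟩) * kernelAct κ g (z ⟨n, Finset.mem_Iic.2 le_rfl⟩) :=
    (hf.comp (h_coord _)).mul (hg.act.comp (h_coord _))
  have : IsProbabilityMeasure ((markovChainLaw κ μ).map past) :=
    Measure.isProbabilityMeasure_map h_past.aemeasurable
  refine (integral_map h_pair.aemeasurable hF.1.aestronglyMeasurable).symm.trans ?_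
  rw [← h_step, Measure.integral_compProd (hF.integrable _)]
  simp only [integral_const_mul]
  exact integral_map h_past.aemeasurable hG.1.aestronglyMeasurable

theorem integral_mul_add_markovChainLaw (hf : BddMeasurable c f) (hg : BddMeasurable c' g)
    (i j : ℕ) :
    ∫ θ, f (θ i) * g (θ (i + j)) ∂markovChainLaw κ μ =
      ∫ θ, f (θ i) * (kernelAct κ)^[j] g (θ i) ∂markovChainLaw κ μ := by
  induction j generalizing g with
  | zero => rfl
  | succ j ih =>
    rw [← add_assoc, integral_mul_succ_markovChainLaw hf hg (Nat.le_add_right i j), ih hg.act,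
      Function.iterate_succ]
    rfl

theorem integral_iterate_kernelAct (h : Kernel.Invariant κ μ) (hf : BddMeasurable c f) (j : ℕ) :
    ∫ u, (kernelAct κ)^[j] f u ∂μ = ∫ u, f u ∂μ := by
  induction j with
  | zero => rfl
  | succ j ih => rw [Function.iterate_succ_apply', integral_kernelAct h (hf.iterate j), ih]

theorem integral_markovChainLaw (h : Kernel.Invariant κ μ) (hf : BddMeasurable c f) (i : ℕ) :
    ∫ θ, f (θ i) ∂markovChainLaw κ μ = ∫ u, f u ∂μ := by
  have h_zero := integral_mul_add_markovChainLaw (κ := κ) (μ := μ) (.const 1) hf 0 i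
  simp only [one_mul, zero_add] at h_zero
  rw [h_zero, ← integral_iterate_kernelAct h hf i]
  conv_rhs => rw [← markovChainLaw_map_zero κ μ]
  exact (integral_map (measurable_pi_apply 0).aemeasurable
    (hf.iterate i).1.aestronglyMeasurable).symm

theorem isStationaryChain_markovChainLaw (h : Kernel.Invariant κ μ) :
    IsStationaryChain κ μ (markovChainLaw κ μ) := by
  intro f g c c' hf hg i j
  rw [integral_mul_add_markovChainLaw hf hg, integral_markovChainLaw h (hf.mul (hg.iterate j))]

end MarkovChain

/-! ### Metropolis–Hastings kernels and chains -/

section Metropolis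

variable {α β : Type*} [MeasurableSpace α] [MeasurableSpace β]

theorem bddMeasurable_unitInterval {A : β → unitInterval} (hA : Measurable A) :
    BddMeasurable 1 fun v => (A v : ℝ) :=
  ⟨measurable_subtype_coe.comp hA, fun v => by rw [abs_of_nonneg (A v).2.1]; exact (A v).2.2⟩

theorem measurable_ofReal_unitInterval {A : β → unitInterval} (hA : Measurable A) :
    Measurable fun v => ENNReal.ofReal (A v) :=
  ENNReal.measurable_ofReal.comp (measurable_subtype_coe.comp hA)

/-- The joint law `μ(du) Q(u, dv) A(u, v)` of a state `u ∼ μ` and a proposed move to `v` that is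
accepted, a measure of mass at most `1`. -/
noncomputable def acceptedMove (μ : Measure β) (Q : Kernel β β) (A : β → β → unitInterval) :
    Measure (β × β) :=
  (μ ⊗ₘ Q).withDensity fun z => ENNReal.ofReal (A z.1 z.2)

theorem acceptedMove_prod {μ : Measure β} [SFinite μ] {Q : Kernel β β} [IsSFiniteKernel Q]
    {A : β → β → unitInterval} (hA : Measurable fun z : β × β => A z.1 z.2) {B C : Set β}
    (hB : MeasurableSet B) (hC : MeasurableSet C) :
    acceptedMove μ Q A (B ×ˢ C) =
      ∫⁻ u in B, (Q u).withDensity (fun v => ENNReal.ofReal (A u v)) C ∂μ := by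
  rw [acceptedMove, withDensity_apply _ (hB.prod hC),
    Measure.setLIntegral_compProd (measurable_ofReal_unitInterval hA) hB hC]
  simp only [withDensity_apply _ hC]

variable {Q : Kernel (α × β) β} [IsMarkovKernel Q] {A : α → β → β → unitInterval}

theorem metropolisKernel_apply (hA : Measurable fun z : (α × β) × β => A z.1.1 z.1.2 z.2)
    (z : α × β) :
    metropolisKernel Q A z = (Q z).withDensity (fun v => ENNReal.ofReal (A z.1 z.2 v)) +
      (1 - ∫⁻ v, ENNReal.ofReal (A z.1 z.2 v) ∂Q z) • Measure.dirac z.2 := by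
  have h_acc : Measurable (Function.uncurry fun (z : α × β) (v : β) =>
      ENNReal.ofReal (A z.1 z.2 v)) := measurable_ofReal_unitInterval hA
  have h_rej : Measurable (Function.uncurry fun (z : α × β) (_ : β) =>
      1 - ∫⁻ v, ENNReal.ofReal (A z.1 z.2 v) ∂(Q z)) :=
    (measurable_const.sub (Measurable.lintegral_kernel_prod_right h_acc)).comp measurable_fst
  rw [metropolisKernel, add_apply, Kernel.withDensity_apply _ h_acc,
    Kernel.withDensity_apply _ h_rej, withDensity_const, Kernel.deterministic_apply]

/-- Rejected moves are on the diagonal, so detailed balance of the accepted moves is enough. -/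
theorem isReversible_metropolisKernel
    (hA : Measurable fun z : (α × β) × β => A z.1.1 z.1.2 z.2) {a : α} {μ : Measure β} [SFinite μ]
    (h_balance : (acceptedMove μ (Q.sectR a) (A a)).map Prod.swap =
      acceptedMove μ (Q.sectR a) (A a)) :
    Kernel.IsReversible ((metropolisKernel Q A).sectR a) μ := by
  have hAa : Measurable fun z : β × β => A a z.1 z.2 :=
    hA.comp (by fun_prop : Measurable fun z : β × β => ((a, z.1), z.2))
  have h_flow {B C : Set β} (hB : MeasurableSet B) (hC : MeasurableSet C) :
      ∫⁻ u in B, (metropolisKernel Q A).sectR a u C ∂μ =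
        acceptedMove μ (Q.sectR a) (A a) (B ×ˢ C) +
          ∫⁻ u in C ∩ B, (1 - ∫⁻ v, ENNReal.ofReal (A a u v) ∂Q (a, u)) ∂μ := by
    simp only [Kernel.sectR_apply, metropolisKernel_apply hA, Measure.add_apply,
      Measure.smul_apply, Measure.dirac_apply' _ hC, smul_eq_mul, acceptedMove_prod hAa hB hC]
    rw [lintegral_add_left, ← Measure.restrict_restrict hC, ← lintegral_indicator hC]
    · congr 2
      funext u
      by_cases hu : u ∈ C <;> simp [hu]
    · simp only [withDensity_apply _ hC]
      exact Measurable.lintegral_kernel_prod_right (κ := (Q.sectR a).restrict hC)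
        (measurable_ofReal_unitInterval hAa)
  intro B C hB hC
  rw [h_flow hB hC, h_flow hC hB, Set.inter_comm]
  conv_lhs => rw [← h_balance, Measure.map_apply measurable_swap (hB.prod hC)]
  rw [Set.preimage_swap_prod]

theorem kernelAct_metropolisKernel (hA : Measurable fun z : (α × β) × β => A z.1.1 z.1.2 z.2)
    {h : β → ℝ} {c : ℝ} (hh : BddMeasurable c h) (a : α) (u : β) :
    kernelAct ((metropolisKernel Q A).sectR a) h u =
      h u + ∫ v, A a u v * (h v - h u) ∂Q.sectR a u := by
  have := isMarkovKernel_metropolisKernel Q A hA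
  have hAu : BddMeasurable 1 fun v => (A a u v : ℝ) :=
    bddMeasurable_unitInterval (hA.comp (by fun_prop : Measurable fun v => ((a, u), v)))
  have h_int : Integrable h (metropolisKernel Q A (a, u)) := hh.integrable _
  have h_rej : (1 - ∫⁻ v, ENNReal.ofReal (A a u v) ∂Q (a, u)).toReal =
      1 - ∫ v, (A a u v : ℝ) ∂Q (a, u) := by
    have h_nonneg : 0 ≤ ∫ v, (A a u v : ℝ) ∂Q (a, u) := integral_nonneg fun v => (A a u v).2.1
    have h_le_one := (le_abs_self _).trans (hAu.abs_integral_le (μ := Q (a, u)))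
    rw [← ofReal_integral_eq_lintegral_ofReal (hAu.integrable _)
      (ae_of_all _ fun v => (A a u v).2.1), ← ENNReal.ofReal_one,
      ← ENNReal.ofReal_sub _ h_nonneg, ENNReal.toReal_ofReal (sub_nonneg.2 h_le_one)]
  change ∫ v, h v ∂metropolisKernel Q A (a, u) = h u + ∫ v, A a u v * (h v - h u) ∂Q (a, u)
  rw [metropolisKernel_apply hA] at h_int ⊢
  rw [integral_add_measure (h_int.mono_measure (Measure.le_add_right le_rfl))
      (h_int.mono_measure (Measure.le_add_left le_rfl)),
    integral_withDensity_eq_integral_toReal_smul hAu.1.ennreal_ofReal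
      (ae_of_all _ fun _ => ENNReal.ofReal_lt_top),
    integral_smul_measure, integral_dirac' _ _ hh.1.stronglyMeasurable, h_rej]
  simp only [ENNReal.toReal_ofReal (A a u _).2.1, smul_eq_mul, mul_sub]
  rw [integral_sub ((hAu.mul hh).integrable _) ((hAu.integrable _).mul_const _),
    integral_mul_const]
  ring

theorem integral_mul_kernelAct_metropolisKernel_sub
    (hA : Measurable fun z : (α × β) × β => A z.1.1 z.1.2 z.2) (a : α) {μ : Measure β}
    [IsFiniteMeasure μ] {φ h : β → ℝ} {c c' : ℝ} (hφ : BddMeasurable c φ)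
    (hh : BddMeasurable c' h) :
    ∫ u, φ u * (kernelAct ((metropolisKernel Q A).sectR a) h u - h u) ∂μ =
      ∫ z, φ z.1 * (h z.2 - h z.1) ∂acceptedMove μ (Q.sectR a) (A a) := by
  have hAa : Measurable fun z : β × β => A a z.1 z.2 :=
    hA.comp (by fun_prop : Measurable fun z : β × β => ((a, z.1), z.2))
  have hF := (bddMeasurable_unitInterval hAa).mul
    ((hφ.comp measurable_fst).mul ((hh.comp measurable_snd).sub (hh.comp measurable_fst)))
  rw [acceptedMove, integral_withDensity_eq_integral_toReal_smul
    (measurable_ofReal_unitInterval hAa) (ae_of_all _ fun _ => ENNReal.ofReal_lt_top)]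
  simp only [ENNReal.toReal_ofReal (A a _ _).2.1, smul_eq_mul]
  rw [Measure.integral_compProd (hF.integrable _)]
  refine integral_congr_ae (ae_of_all _ fun u => ?_)
  simp only [kernelAct_metropolisKernel hA hh, add_sub_cancel_left, ← integral_const_mul,
    mul_left_comm]

end Metropolis

namespace MetropolisHastings

variable {𝒳 T : Type*} [MeasurableSpace 𝒳] [MeasurableSpace T] (M : MetropolisHastings 𝒳 T)

theorem invariant_kernel (x : 𝒳) : Kernel.Invariant (M.kernel.sectR x) (M.target x) :=
  have : IsMarkovKernel ((metropolisKernel M.proposal M.accept).sectR x) :=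
    inferInstanceAs (IsMarkovKernel (M.kernel.sectR x))
  (isReversible_metropolisKernel M.measurable_accept (M.balance x)).invariant

theorem step_apply (x : 𝒳) (u : T) : M.step (x, u) = (M.kernel (x, u)).map (Prod.mk x) := by
  rw [step, Kernel.prod_apply, Kernel.deterministic_apply, Measure.dirac_prod]

theorem invariant_step (x : 𝒳) : Kernel.Invariant M.step ((M.target x).map (Prod.mk x)) := by
  ext B hB
  rw [Measure.bind_apply hB (Kernel.aemeasurable _),
    lintegral_map (M.step.measurable_coe hB) measurable_prodMk_left,
    Measure.map_apply measurable_prodMk_left hB]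
  conv_rhs => rw [← (M.invariant_kernel x).def]
  rw [Measure.bind_apply (measurable_prodMk_left hB) (Kernel.aemeasurable _)]
  refine lintegral_congr fun u => ?_
  rw [step_apply, Measure.map_apply measurable_prodMk_left hB, Kernel.sectR_apply]

theorem iterate_kernelAct_step (x : 𝒳) {f : 𝒳 × T → ℝ} {c : ℝ} (hf : BddMeasurable c f) (j : ℕ)
    (u : T) :
    (kernelAct M.step)^[j] f (x, u) =
      (kernelAct (M.kernel.sectR x))^[j] (fun v => f (x, v)) u := by
  induction j generalizing u with
  | zero => rfl
  | succ j ih =>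
    rw [Function.iterate_succ_apply', Function.iterate_succ_apply', kernelAct, step_apply,
      integral_map measurable_prodMk_left.aemeasurable (hf.iterate j).1.aestronglyMeasurable]
    simp only [ih, kernelAct, Kernel.sectR_apply]

theorem chain_apply (x : 𝒳) :
    M.chain x =
      (markovChainLaw M.step ((M.target x).map (Prod.mk x))).map fun ω m => (ω m).2 := by
  rw [chain, Kernel.map_apply _ (by fun_prop), Kernel.comp_apply,
    Kernel.map_apply _ (by fun_prop), Kernel.prod_apply, Kernel.id_apply, Measure.dirac_prod]
  rfl

instance (x : 𝒳) : IsProbabilityMeasure ((M.target x).map (Prod.mk x)) :=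
  Measure.isProbabilityMeasure_map measurable_prodMk_left.aemeasurable

instance : IsMarkovKernel M.chain := by
  refine ⟨fun x => ?_⟩
  rw [chain_apply]
  have h_chain : Measurable fun (ω : ℕ → 𝒳 × T) m => (ω m).2 := by fun_prop
  exact Measure.isProbabilityMeasure_map h_chain.aemeasurable

theorem isStationaryChain_chain (x : 𝒳) :
    IsStationaryChain (M.kernel.sectR x) (M.target x) (M.chain x) := by
  intro f g c c' hf hg i j
  have hf' : BddMeasurable c fun z : 𝒳 × T => f z.2 := hf.comp measurable_snd
  have hg' : BddMeasurable c' fun z : 𝒳 × T => g z.2 := hg.comp measurable_snd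
  have h_chain : Measurable fun (ω : ℕ → 𝒳 × T) m => (ω m).2 := by fun_prop
  have hfg : Measurable fun θ : ℕ → T => f (θ i) * g (θ (i + j)) :=
    (hf.1.comp (measurable_pi_apply _)).mul (hg.1.comp (measurable_pi_apply _))
  rw [chain_apply, integral_map h_chain.aemeasurable hfg.aestronglyMeasurable]
  refine (isStationaryChain_markovChainLaw (M.invariant_step x) hf' hg' i j).trans ?_
  rw [integral_map measurable_prodMk_left.aemeasurable
    (hf'.mul (hg'.iterate j)).1.aestronglyMeasurable]
  simp only [iterate_kernelAct_step _ _ hg']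

end MetropolisHastings

/-! ### Total variation distance -/

section TotalVariation

variable {E F : Type*} [MeasurableSpace E] [MeasurableSpace F] {μ ν : Measure E}

theorem tvDist_nonneg (μ ν : Measure E) : 0 ≤ tvDist μ ν :=
  Real.iSup_nonneg fun _ => abs_nonneg _

theorem tvDist_le {a : ℝ} (ha : 0 ≤ a)
    (h : ∀ f : E → ℝ, BddMeasurable 1 f → |∫ x, f x ∂μ - ∫ x, f x ∂ν| ≤ a) : tvDist μ ν ≤ a :=
  Real.iSup_le (fun f => h f.1 f.2) ha

theorem abs_integral_sub_le_mul_tvDist [IsFiniteMeasure μ] [IsFiniteMeasure ν] {f : E → ℝ} {c : ℝ}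
    (hc : 0 ≤ c) (hf : BddMeasurable c f) :
    |∫ x, f x ∂μ - ∫ x, f x ∂ν| ≤ c * tvDist μ ν := by
  have h_norm {g : E → ℝ} (hg : BddMeasurable 1 g) (ρ : Measure E) [IsFiniteMeasure ρ] :
      |∫ x, g x ∂ρ| ≤ ρ.real Set.univ := by
    simpa using norm_integral_le_of_norm_le_const (μ := ρ) (f := g) (ae_of_all _ hg.2)
  have h_one {g : E → ℝ} (hg : BddMeasurable 1 g) : |∫ x, g x ∂μ - ∫ x, g x ∂ν| ≤ tvDist μ ν := by
    refine le_ciSup (f := fun g : {g : E → ℝ // Measurable g ∧ ∀ x, |g x| ≤ 1} =>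
      |∫ x, g.1 x ∂μ - ∫ x, g.1 x ∂ν|) ⟨μ.real Set.univ + ν.real Set.univ, ?_⟩ ⟨g, hg⟩
    rintro _ ⟨g, rfl⟩
    exact (abs_sub _ _).trans (add_le_add (h_norm g.2 μ) (h_norm g.2 ν))
  obtain rfl | hc := hc.eq_or_lt
  · have h_zero : f = 0 := funext fun x => abs_nonpos_iff.1 (hf.2 x)
    simp [h_zero]
  · have h_scaled : BddMeasurable 1 fun x => c⁻¹ * f x := by
      refine ⟨hf.1.const_mul _, fun x => ?_⟩
      rw [abs_mul, abs_inv, abs_of_pos hc, inv_mul_le_one₀ hc]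
      exact hf.2 x
    have h_le := h_one h_scaled
    rwa [integral_const_mul, integral_const_mul, ← mul_sub, abs_mul, abs_inv, abs_of_pos hc,
      inv_mul_le_iff₀ hc] at h_le

theorem abs_measureReal_sub_le_tvDist [IsFiniteMeasure μ] [IsFiniteMeasure ν] {B : Set E}
    (hB : MeasurableSet B) : |μ.real B - ν.real B| ≤ tvDist μ ν := by
  simpa only [integral_indicator_one hB, one_mul] using
    abs_integral_sub_le_mul_tvDist (μ := μ) (ν := ν) zero_le_one (bddMeasurable_indicator hB)

theorem tvDist_triangle (μ ν ρ : Measure E) [IsFiniteMeasure μ] [IsFiniteMeasure ν]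
    [IsFiniteMeasure ρ] : tvDist μ ρ ≤ tvDist μ ν + tvDist ν ρ := by
  refine tvDist_le (add_nonneg (tvDist_nonneg _ _) (tvDist_nonneg _ _)) fun f hf => ?_
  have hμν := abs_integral_sub_le_mul_tvDist (μ := μ) (ν := ν) zero_le_one hf
  have hνρ := abs_integral_sub_le_mul_tvDist (μ := ν) (ν := ρ) zero_le_one hf
  rw [one_mul] at hμν hνρ
  exact (abs_sub_le _ _ _).trans (add_le_add hμν hνρ)

theorem tvDist_map_le [IsFiniteMeasure μ] [IsFiniteMeasure ν] {l : E → F} (hl : Measurable l) :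
    tvDist (μ.map l) (ν.map l) ≤ tvDist μ ν := by
  refine tvDist_le (tvDist_nonneg _ _) fun f hf => ?_
  rw [integral_map hl.aemeasurable hf.1.aestronglyMeasurable,
    integral_map hl.aemeasurable hf.1.aestronglyMeasurable]
  simpa only [one_mul] using
    abs_integral_sub_le_mul_tvDist (μ := μ) (ν := ν) zero_le_one (hf.comp hl)

theorem tvDist_withDensity_le {f g : E → ℝ≥0} (hf : Measurable f) (hg : Measurable g)
    (hf_int : Integrable (fun x => (f x : ℝ)) μ) (hg_int : Integrable (fun x => (g x : ℝ)) μ) :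
    tvDist (μ.withDensity fun x => f x) (μ.withDensity fun x => g x) ≤
      ∫ x, |(f x : ℝ) - g x| ∂μ := by
  refine tvDist_le (integral_nonneg fun _ => abs_nonneg _) fun h hh => ?_
  have h_int {k : E → ℝ} (hk : Integrable k μ) : Integrable (fun x => k x * h x) μ :=
    hk.mul_bdd hh.1.aestronglyMeasurable (ae_of_all _ hh.2)
  simp only [integral_withDensity_eq_integral_smul hf, integral_withDensity_eq_integral_smul hg,
    NNReal.smul_def, smul_eq_mul]
  rw [← integral_sub (h_int hf_int) (h_int hg_int)]
  refine abs_integral_le_integral_abs.trans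
    (integral_mono ((h_int hf_int).sub (h_int hg_int)).abs (hf_int.sub hg_int).abs fun x => ?_)
  simp only [← sub_mul, abs_mul]
  exact mul_le_of_le_one_right (abs_nonneg _) (hh.2 x)

theorem tvDist_withDensity_unitInterval_le [IsFiniteMeasure μ] [IsFiniteMeasure ν]
    {A B : E → unitInterval} (hA : Measurable A) (hB : Measurable B) :
    tvDist (μ.withDensity fun x => ENNReal.ofReal (A x))
        (ν.withDensity fun x => ENNReal.ofReal (B x)) ≤
      tvDist μ ν + ∫ x, |(A x : ℝ) - B x| ∂ν := by
  have hA' := bddMeasurable_unitInterval hA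
  have hB' := bddMeasurable_unitInterval hB
  have h_weight {C : E → unitInterval} (hC : Measurable C) (ρ : Measure E) (f : E → ℝ) :
      ∫ x, f x ∂ρ.withDensity (fun x => ENNReal.ofReal (C x)) = ∫ x, C x * f x ∂ρ := by
    rw [integral_withDensity_eq_integral_toReal_smul (measurable_ofReal_unitInterval hC)
      (ae_of_all _ fun _ => ENNReal.ofReal_lt_top)]
    simp only [ENNReal.toReal_ofReal (C _).2.1, smul_eq_mul]
  refine tvDist_le (add_nonneg (tvDist_nonneg _ _) (integral_nonneg fun _ => abs_nonneg _))
    fun f hf => ?_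
  rw [h_weight hA, h_weight hB]
  refine (abs_sub_le _ (∫ x, A x * f x ∂ν) _).trans (add_le_add ?_ ?_)
  · simpa only [mul_one, one_mul] using
      abs_integral_sub_le_mul_tvDist (μ := μ) (ν := ν) (by norm_num) (hA'.mul hf)
  · rw [← integral_sub ((hA'.mul hf).integrable _) ((hB'.mul hf).integrable _)]
    refine abs_integral_le_integral_abs.trans (integral_mono
      (((hA'.mul hf).sub (hB'.mul hf)).abs.integrable _) ((hA'.sub hB').abs.integrable _)
      fun x => ?_)
    simp only [← sub_mul, abs_mul]
    exact mul_le_of_le_one_right (abs_nonneg _) (hf.2 x)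

theorem map_withDensity_comp {l : E → F} (hl : Measurable l) {w : F → ℝ≥0∞} (hw : Measurable w) :
    (μ.withDensity fun x => w (l x)).map l = (μ.map l).withDensity w := by
  ext B hB
  rw [Measure.map_apply hl hB, withDensity_apply _ (hl hB), withDensity_apply _ hB,
    setLIntegral_map hB hw hl]

end TotalVariation

/-! ### Comparison of a kernel with a limit kernel -/

section Comparison

variable {α α' E T : Type*} [MeasurableSpace α] [MeasurableSpace α'] [MeasurableSpace E]
  [MeasurableSpace T]

instance {μ : Measure E} [IsFiniteMeasure μ] {Q : Kernel E E} [IsMarkovKernel Q]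
    {A : E → E → unitInterval} : IsFiniteMeasure (acceptedMove μ Q A) := by
  refine isFiniteMeasure_withDensity (ne_top_of_le_ne_top (measure_ne_top (μ ⊗ₘ Q) Set.univ) ?_)
  calc ∫⁻ z, ENNReal.ofReal (A z.1 z.2) ∂(μ ⊗ₘ Q) ≤ ∫⁻ _, 1 ∂(μ ⊗ₘ Q) :=
        lintegral_mono fun z => ENNReal.ofReal_le_one.2 (A z.1 z.2).2.2
    _ = (μ ⊗ₘ Q) Set.univ := lintegral_one

theorem exists_bddMeasurable_comp_mul_eq_abs {l : T → E} (hl : MeasurableEmbedding l) {f : T → ℝ}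
    (hf : Measurable f) : ∃ φ : E → ℝ, BddMeasurable 1 φ ∧ ∀ u, φ (l u) * f u = |f u| := by
  classical
  have hB : MeasurableSet (l '' {u | 0 ≤ f u}) :=
    hl.measurableSet_image.2 (measurableSet_le measurable_const hf)
  refine ⟨(l '' {u | 0 ≤ f u}).piecewise 1 (-1),
    ⟨measurable_one.piecewise hB measurable_one.neg, fun y => ?_⟩, fun u => ?_⟩
  · by_cases hy : y ∈ l '' {u | 0 ≤ f u} <;> simp [hy]
  · by_cases hu : 0 ≤ f u
    · simp [hl.injective.mem_set_image, hu, abs_of_nonneg hu]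
    · simp [hl.injective.mem_set_image, hu, abs_of_neg (not_le.1 hu)]

/-- Testing against the sign of the difference turns the left-hand side into integrals of
`φ(u) (h(v) - h(u))` with respect to the two accepted-move measures. -/
theorem integral_abs_kernelAct_metropolisKernel_sub_le {l : T → E} (hl : MeasurableEmbedding l)
    {Q' : Kernel (α' × T) T} [IsMarkovKernel Q'] {A' : α' → T → T → unitInterval}
    (hA' : Measurable fun z : (α' × T) × T => A' z.1.1 z.1.2 z.2) (a' : α')
    {Q : Kernel (α × E) E} [IsMarkovKernel Q] {A : α → E → E → unitInterval}
    (hA : Measurable fun z : (α × E) × E => A z.1.1 z.1.2 z.2) (a : α)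
    {μ' : Measure T} [IsFiniteMeasure μ'] {μ : Measure E} [IsFiniteMeasure μ] {h : E → ℝ}
    (hh : BddMeasurable 1 h) :
    ∫ u, |kernelAct ((metropolisKernel Q' A').sectR a') (fun x => h (l x)) u -
        kernelAct ((metropolisKernel Q A).sectR a) h (l u)| ∂μ' ≤
      2 * tvDist ((acceptedMove μ' (Q'.sectR a') (A' a')).map (Prod.map l l))
          (acceptedMove μ (Q.sectR a) (A a)) + 2 * tvDist (μ'.map l) μ := by
  have := isMarkovKernel_metropolisKernel Q' A' hA'
  have := isMarkovKernel_metropolisKernel Q A hA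
  set κ' := (metropolisKernel Q' A').sectR a'
  set κ := (metropolisKernel Q A).sectR a
  have hhl := hh.comp hl.measurable
  have h_diff := (hhl.act (κ := κ')).sub ((hh.act (κ := κ)).comp hl.measurable)
  obtain ⟨φ, hφ, h_sign⟩ := exists_bddMeasurable_comp_mul_eq_abs hl h_diff.1
  have hφl := hφ.comp hl.measurable
  have h_incr : BddMeasurable 2 fun u => φ u * (kernelAct κ h u - h u) := by
    simpa only [one_mul, one_add_one_eq_two] using hφ.mul ((hh.act (κ := κ)).sub hh)
  have h_pair : BddMeasurable 2 fun z : E × E => φ z.1 * (h z.2 - h z.1) := by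
    simpa only [one_mul, one_add_one_eq_two] using
      (hφ.comp measurable_fst).mul ((hh.comp measurable_snd).sub (hh.comp measurable_fst))
  set γ' := acceptedMove μ' (Q'.sectR a') (A' a')
  set γ := acceptedMove μ (Q.sectR a) (A a)
  have h_split : ∫ u, |kernelAct κ' (fun x => h (l x)) u - kernelAct κ h (l u)| ∂μ' =
      ∫ u, φ (l u) * (kernelAct κ' (fun x => h (l x)) u - h (l u)) ∂μ' -
        ∫ u, φ (l u) * (kernelAct κ h (l u) - h (l u)) ∂μ' := by
    rw [← integral_sub ((hφl.mul ((hhl.act (κ := κ')).sub hhl)).integrable _)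
      ((h_incr.comp hl.measurable).integrable _)]
    refine integral_congr_ae (ae_of_all _ fun u => ?_)
    simp only [← h_sign]
    ring
  have h_γ' : ∫ z, φ z.1 * (h z.2 - h z.1) ∂γ'.map (Prod.map l l) =
      ∫ u, φ (l u) * (kernelAct κ' (fun x => h (l x)) u - h (l u)) ∂μ' := by
    rw [integral_map (hl.measurable.prodMap hl.measurable).aemeasurable
      h_pair.1.aestronglyMeasurable]
    exact (integral_mul_kernelAct_metropolisKernel_sub hA' a' hφl hhl).symm
  have h_γ := integral_mul_kernelAct_metropolisKernel_sub (Q := Q) hA a (μ := μ) hφ hh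
  have h_tv := abs_integral_sub_le_mul_tvDist (μ := γ'.map (Prod.map l l)) (ν := γ) two_pos.le
    h_pair
  have h_tv_μ := abs_integral_sub_le_mul_tvDist (μ := μ'.map l) (ν := μ) two_pos.le h_incr
  rw [integral_map hl.measurable.aemeasurable h_incr.1.aestronglyMeasurable] at h_tv_μ
  rw [h_γ', ← h_γ] at h_tv
  rw [h_split]
  linarith [(abs_le.1 h_tv).2, (abs_le.1 h_tv_μ).1]

/-- The pair `(κ', μ')` of a kernel and a law on `T` is `δ`-close to the pair `(κ, μ)` on `E`, when
`T` is mapped to `E` by `l`: the laws are close in total variation and the actions of the kernels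
are close in `L¹(μ')`, uniformly over test functions with values in `[-1, 1]`. -/
structure IsCloseAlong (l : T → E) (κ' : Kernel T T) (μ' : Measure T) (κ : Kernel E E)
    (μ : Measure E) (δ : ℝ) : Prop where
  tvDist_le : tvDist (μ'.map l) μ ≤ δ
  integral_abs_kernelAct_sub_le : ∀ ⦃h : E → ℝ⦄, BddMeasurable 1 h →
    ∫ u, |kernelAct κ' (fun x => h (l x)) u - kernelAct κ h (l u)| ∂μ' ≤ δ

theorem IsCloseAlong.mono {l : T → E} {κ' : Kernel T T} {μ' : Measure T} {κ : Kernel E E}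
    {μ : Measure E} {δ δ' : ℝ} (h : IsCloseAlong l κ' μ' κ μ δ) (hδ : δ ≤ δ') :
    IsCloseAlong l κ' μ' κ μ δ' :=
  ⟨h.1.trans hδ, fun _ hh => (h.2 hh).trans hδ⟩

variable {l : T → E} {κ' : Kernel T T} {μ' : Measure T} [IsProbabilityMeasure μ'] {κ : Kernel E E}
  {μ : Measure E} {δ : ℝ} {h : E → ℝ} {B : Set E}

namespace IsCloseAlong

theorem abs_measureReal_sub_le [IsProbabilityMeasure μ] (h_close : IsCloseAlong l κ' μ' κ μ δ)
    (hl : Measurable l) (hB : MeasurableSet B) :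
    |μ.real B - μ'.real (l ⁻¹' B)| ≤ δ := by
  rw [abs_sub_comm, ← map_measureReal_apply hl hB]
  exact (abs_measureReal_sub_le_tvDist hB).trans h_close.tvDist_le

variable [IsMarkovKernel κ'] [IsMarkovKernel κ]

theorem integral_abs_iterate_sub_le (h_close : IsCloseAlong l κ' μ' κ μ δ) (hl : Measurable l)
    (h_inv : Kernel.Invariant κ' μ') (hh : BddMeasurable 1 h) (j : ℕ) :
    ∫ u, |(kernelAct κ')^[j] (fun x => h (l x)) u - (kernelAct κ)^[j] h (l u)| ∂μ' ≤ j * δ := by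
  induction j with
  | zero => simp
  | succ j ih =>
    set f' := (kernelAct κ')^[j] fun x => h (l x)
    set f := (kernelAct κ)^[j] h
    have hf' : BddMeasurable 1 f' := (hh.comp hl).iterate j
    have hf : BddMeasurable 1 f := hh.iterate j
    have h_first := (hf'.act (κ := κ')).sub ((hf.comp hl).act (κ := κ'))
    have h_second := ((hf.comp hl).act (κ := κ')).sub ((hf.act (κ := κ)).comp hl)
    simp only [Function.iterate_succ_apply']
    calc ∫ u, |kernelAct κ' f' u - kernelAct κ f (l u)| ∂μ'
        ≤ ∫ u, (|kernelAct κ' f' u - kernelAct κ' (fun x => f (l x)) u| +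
            |kernelAct κ' (fun x => f (l x)) u - kernelAct κ f (l u)|) ∂μ' :=
          integral_mono ((hf'.act.sub (hf.act.comp hl)).abs.integrable _)
            ((h_first.abs.add h_second.abs).integrable _) fun u => abs_sub_le _ _ _
      _ = ∫ u, |kernelAct κ' (fun x => f' x - f (l x)) u| ∂μ' +
            ∫ u, |kernelAct κ' (fun x => f (l x)) u - kernelAct κ f (l u)| ∂μ' := by
          rw [kernelAct_sub hf' (hf.comp hl)]
          exact integral_add (h_first.abs.integrable _) (h_second.abs.integrable _)
      _ ≤ j * δ + δ := add_le_add
          ((integral_abs_kernelAct_le h_inv (hf'.sub (hf.comp hl))).trans ih)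
          (h_close.integral_abs_kernelAct_sub_le hf)
      _ = (j + 1 : ℕ) * δ := by push_cast; ring

theorem integral_abs_kernelSum_sub_le (h_close : IsCloseAlong l κ' μ' κ μ δ) (hl : Measurable l)
    (h_inv : Kernel.Invariant κ' μ') (hh : BddMeasurable 1 h) (k : ℕ) :
    ∫ u, |kernelSum κ' k (fun x => h (l x)) u - kernelSum κ k h (l u)| ∂μ' ≤ k * (k * δ) := by
  have h_nonneg : 0 ≤ δ := (tvDist_nonneg _ _).trans h_close.tvDist_le
  have h_diff (j : ℕ) := ((hh.comp hl).iterate (κ := κ') j).sub ((hh.iterate (κ := κ) j).comp hl)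
  calc ∫ u, |kernelSum κ' k (fun x => h (l x)) u - kernelSum κ k h (l u)| ∂μ'
      ≤ ∫ u, ∑ j ∈ Finset.range k,
          |(kernelAct κ')^[j] (fun x => h (l x)) u - (kernelAct κ)^[j] h (l u)| ∂μ' := by
        refine integral_mono
          ((((hh.comp hl).kernelSum k).sub ((hh.kernelSum k).comp hl)).abs.integrable _)
          (integrable_finsetSum _ fun j _ => (h_diff j).abs.integrable _) fun u => ?_
        simp only [kernelSum, ← Finset.sum_sub_distrib]
        exact Finset.abs_sum_le_sum_abs _ _
    _ = ∑ j ∈ Finset.range k,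
          ∫ u, |(kernelAct κ')^[j] (fun x => h (l x)) u - (kernelAct κ)^[j] h (l u)| ∂μ' :=
        integral_finsetSum _ fun j _ => (h_diff j).abs.integrable _
    _ ≤ ∑ _j ∈ Finset.range k, k * δ := Finset.sum_le_sum fun j hj =>
        (h_close.integral_abs_iterate_sub_le hl h_inv hh j).trans
          (mul_le_mul_of_nonneg_right (by exact_mod_cast (Finset.mem_range.1 hj).le) h_nonneg)
    _ = k * (k * δ) := by rw [Finset.sum_const, Finset.card_range, nsmul_eq_mul]

variable [IsProbabilityMeasure μ]

theorem integral_abs_kernelSum_le (h_close : IsCloseAlong l κ' μ' κ μ δ) (hl : Measurable l)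
    (h_inv : Kernel.Invariant κ' μ') (hh : BddMeasurable 1 h) (k : ℕ) :
    ∫ u, |kernelSum κ' k (fun x => h (l x)) u| ∂μ' ≤
      ∫ y, |kernelSum κ k h y| ∂μ + k * δ + k * (k * δ) := by
  have h_sum' := (hh.comp hl).kernelSum (κ := κ') k
  have h_sum : BddMeasurable k (kernelSum κ k h) := by simpa only [mul_one] using hh.kernelSum k
  have h_map := (abs_le.1 (abs_integral_sub_le_mul_tvDist (μ := μ'.map l) (ν := μ)
    (Nat.cast_nonneg k) h_sum.abs)).2
  rw [integral_map hl.aemeasurable h_sum.abs.1.aestronglyMeasurable] at h_map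
  have h_tv := mul_le_mul_of_nonneg_left h_close.tvDist_le (Nat.cast_nonneg (α := ℝ) k)
  calc ∫ u, |kernelSum κ' k (fun x => h (l x)) u| ∂μ'
      ≤ ∫ u, (|kernelSum κ k h (l u)| +
          |kernelSum κ' k (fun x => h (l x)) u - kernelSum κ k h (l u)|) ∂μ' := by
        refine integral_mono (h_sum'.abs.integrable _)
          (((h_sum.comp hl).abs.add (h_sum'.sub (h_sum.comp hl)).abs).integrable _) fun u => ?_
        linarith [abs_sub_abs_le_abs_sub (kernelSum κ' k (fun x => h (l x)) u)
          (kernelSum κ k h (l u))]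
    _ = ∫ u, |kernelSum κ k h (l u)| ∂μ' +
          ∫ u, |kernelSum κ' k (fun x => h (l x)) u - kernelSum κ k h (l u)| ∂μ' :=
        integral_add ((h_sum.comp hl).abs.integrable _)
          ((h_sum'.sub (h_sum.comp hl)).abs.integrable _)
    _ ≤ ∫ y, |kernelSum κ k h y| ∂μ + k * δ + k * (k * δ) :=
        add_le_add (by linarith) (h_close.integral_abs_kernelSum_sub_le hl h_inv hh k)

theorem ergodicDefect_comp_le (h_close : IsCloseAlong l κ' μ' κ μ δ) (hl : Measurable l)
    (h_inv : Kernel.Invariant κ' μ') (hh : BddMeasurable 1 h) {k : ℕ} (hk : 0 < k) :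
    ergodicDefect κ' μ' k (fun x => h (l x)) ≤ ergodicDefect κ μ k h + (k + 1) * δ := by
  have hk' : (0 : ℝ) < k := by exact_mod_cast hk
  rw [ergodicDefect, div_le_iff₀ hk', ergodicDefect, add_mul, div_mul_cancel₀ _ hk'.ne']
  linarith [h_close.integral_abs_kernelSum_le hl h_inv hh k]

end IsCloseAlong

theorem ergodicDefect_sub_const_le [IsMarkovKernel κ'] {f : T → ℝ} {c : ℝ}
    (hf : BddMeasurable c f) (a : ℝ) {k : ℕ} (hk : 0 < k) :
    ergodicDefect κ' μ' k (fun x => f x - a) ≤ ergodicDefect κ' μ' k f + |a| := by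
  have hk' : (0 : ℝ) < k := by exact_mod_cast hk
  have h_sum (u : T) : kernelSum κ' k (fun x => f x - a) u = kernelSum κ' k f u - k * a := by
    simp only [kernelSum, iterate_kernelAct_sub_const hf, Finset.sum_sub_distrib,
      Finset.sum_const, Finset.card_range, nsmul_eq_mul]
  have hf_sum := hf.kernelSum (κ := κ') k
  rw [ergodicDefect, div_le_iff₀ hk', ergodicDefect, add_mul, div_mul_cancel₀ _ hk'.ne']
  calc ∫ u, |kernelSum κ' k (fun x => f x - a) u| ∂μ'
      ≤ ∫ u, (|kernelSum κ' k f u| + |a| * k) ∂μ' := by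
        simp only [h_sum]
        refine integral_mono ((hf_sum.sub (.const (k * a))).abs.integrable _)
          ((hf_sum.abs.integrable _).add (integrable_const _)) fun u => ?_
        exact (abs_sub _ _).trans_eq (by rw [abs_mul, Nat.abs_cast, mul_comm])
    _ = ∫ u, |kernelSum κ' k f u| ∂μ' + |a| * k := by
        rw [integral_add (hf_sum.abs.integrable _) (integrable_const _), integral_const,
          probReal_univ, one_smul]

theorem IsCloseAlong.ergodicDefect_centeredIndicator_le [IsMarkovKernel κ'] [IsMarkovKernel κ]
    [IsProbabilityMeasure μ] (h_close : IsCloseAlong l κ' μ' κ μ δ)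
    (hl : Measurable l) (h_inv : Kernel.Invariant κ' μ') (hB : MeasurableSet B) {k : ℕ}
    (hk : 0 < k) :
    ergodicDefect κ' μ' k (centeredIndicator μ' (l ⁻¹' B)) ≤
      ergodicDefect κ μ k (centeredIndicator μ B) + (k + 2) * δ := by
  have hh : BddMeasurable 1 (centeredIndicator μ B) := bddMeasurable_centeredIndicator hB
  have h_shift : centeredIndicator μ' (l ⁻¹' B) =
      fun x => centeredIndicator μ B (l x) - (μ'.real (l ⁻¹' B) - μ.real B) := by
    funext x
    have h_ind : (l ⁻¹' B).indicator (1 : T → ℝ) x = B.indicator 1 (l x) := rfl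
    rw [centeredIndicator, centeredIndicator, h_ind]
    ring
  have h_mass := h_close.abs_measureReal_sub_le hl hB
  rw [abs_sub_comm] at h_mass
  rw [h_shift]
  linarith [ergodicDefect_sub_const_le (κ' := κ') (μ' := μ') (hh.comp hl)
    (μ'.real (l ⁻¹' B) - μ.real B) hk, h_close.ergodicDefect_comp_le hl h_inv hh hk]

end Comparison

/-! ### Bounding the bounded Lipschitz distance by a partition -/

/-- The sum over the sets `C i` of the differences `|μ (C i) - ν (C i)|`. For a partition `C` into
small sets it dominates the bounded Lipschitz distance up to the mesh, and unlike the latter it is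
measurable in `μ` and `ν`. -/
noncomputable def partitionDist {E : Type*} [MeasurableSpace E] (C : ℕ → Set E)
    (μ ν : Measure E) : ℝ≥0∞ :=
  ∑' i, ENNReal.ofReal |μ.real (C i) - ν.real (C i)|

/-- `C` is a countable partition into measurable sets, some of which may be empty. -/
structure IsMeasurablePartition {E : Type*} [MeasurableSpace E] (C : ℕ → Set E) : Prop where
  measurableSet : ∀ i, MeasurableSet (C i)
  disjoint : Pairwise (Function.onFun Disjoint C)
  iUnion_eq_univ : ⋃ i, C i = Set.univ

section Partition

variable {T E : Type*} [MeasurableSpace T] [MeasurableSpace E] {C : ℕ → Set E} {l : T → E}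

theorem partitionDist_map (hC : ∀ i, MeasurableSet (C i)) (hl : Measurable l) (μ ν : Measure T) :
    partitionDist C (μ.map l) (ν.map l) = partitionDist (fun i => l ⁻¹' C i) μ ν := by
  simp only [partitionDist, map_measureReal_apply hl (hC _)]

theorem tsum_measure_add (hC : ∀ i, MeasurableSet (C i))
    (hd : Pairwise (Function.onFun Disjoint C)) (μ : Measure E) (n : ℕ) :
    ∑' i, μ (C (i + n)) = μ (⋃ i, C (i + n)) :=
  (measure_iUnion (hd.comp_of_injective (add_left_injective n)) fun _ => hC _).symm

theorem tendsto_measure_iUnion_add_atTop (hC : ∀ i, MeasurableSet (C i))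
    (hd : Pairwise (Function.onFun Disjoint C)) (μ : Measure E) [IsFiniteMeasure μ] :
    Tendsto (fun n => μ (⋃ i, C (i + n))) atTop (𝓝 0) := by
  simp only [← tsum_measure_add hC hd μ]
  refine ENNReal.tendsto_sum_nat_add (fun i => μ (C i)) ?_
  rw [← measure_iUnion hd hC]
  exact measure_ne_top _ _

namespace IsMeasurablePartition

theorem hasSum_setIntegral (hC : IsMeasurablePartition C) {μ : Measure E} {f : E → ℝ}
    (hf : Integrable f μ) : HasSum (fun i => ∫ x in C i, f x ∂μ) (∫ x, f x ∂μ) := by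
  simpa only [hC.iUnion_eq_univ, setIntegral_univ] using
    hasSum_integral_iUnion hC.measurableSet hC.disjoint hf.integrableOn

theorem hasSum_measureReal (hC : IsMeasurablePartition C) (μ : Measure E) [IsFiniteMeasure μ] :
    HasSum (fun i => μ.real (C i)) (μ.real Set.univ) := by
  simpa using hC.hasSum_setIntegral (integrable_const (1 : ℝ) (μ := μ))

end IsMeasurablePartition

end Partition

section BoundedLipschitz

theorem abs_setIntegral_sub_mul_measureReal_le {E : Type*} [MeasurableSpace E] {μ : Measure E}
    [IsFiniteMeasure μ] {B : Set E} {f : E → ℝ} {a ε : ℝ} (hf : Integrable f μ)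
    (h : ∀ x ∈ B, |f x - a| ≤ ε) : |∫ x in B, f x ∂μ - a * μ.real B| ≤ ε * μ.real B := by
  have h_sub : ∫ x in B, f x ∂μ - a * μ.real B = ∫ x in B, (f x - a) ∂μ := by
    rw [integral_sub hf.integrableOn (integrable_const _), setIntegral_const, smul_eq_mul, mul_comm]
  rw [h_sub]
  exact norm_setIntegral_le_of_norm_le_const (f := fun x => f x - a) (measure_lt_top _ _) h

theorem abs_setIntegral_sub_setIntegral_le {E : Type*} [MeasurableSpace E] {μ ν : Measure E}
    [IsFiniteMeasure μ] [IsFiniteMeasure ν] {B : Set E} {f : E → ℝ} {a ε : ℝ}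
    (hfμ : Integrable f μ) (hfν : Integrable f ν) (ha : |a| ≤ 1) (h : ∀ x ∈ B, |f x - a| ≤ ε) :
    |∫ x in B, f x ∂μ - ∫ x in B, f x ∂ν| ≤
      |μ.real B - ν.real B| + ε * (μ.real B + ν.real B) := by
  have h_mass : |a * μ.real B - a * ν.real B| ≤ |μ.real B - ν.real B| := by
    rw [← mul_sub, abs_mul]
    exact mul_le_of_le_one_left (abs_nonneg _) ha
  have h_μ := abs_le.1 (abs_setIntegral_sub_mul_measureReal_le hfμ h)
  have h_ν := abs_le.1 (abs_setIntegral_sub_mul_measureReal_le hfν h)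
  have h_a := abs_le.1 h_mass
  rw [abs_le]
  constructor <;> linarith

theorem IsMeasurablePartition.abs_integral_sub_le {E : Type*} [PseudoMetricSpace E]
    [MeasurableSpace E] {C : ℕ → Set E} (hC : IsMeasurablePartition C) {ε : ℝ}
    (h_mesh : ∀ i, ∃ d, C i ⊆ Metric.closedBall d ε) {μ ν : Measure E} [IsProbabilityMeasure μ]
    [IsProbabilityMeasure ν] {f : E → ℝ} (hf : BddMeasurable 1 f)
    (hf_lip : ∀ x y, |f x - f y| ≤ dist x y) :
    |∫ x, f x ∂μ - ∫ x, f x ∂ν| ≤ ∑' i, |μ.real (C i) - ν.real (C i)| + 2 * ε := by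
  have hμ := hC.hasSum_measureReal μ
  have hν := hC.hasSum_measureReal ν
  have h_summable := (hμ.summable.sub hν.summable).abs
  have h_cell (i : ℕ) : |∫ x in C i, f x ∂μ - ∫ x in C i, f x ∂ν| ≤
      |μ.real (C i) - ν.real (C i)| + ε * (μ.real (C i) + ν.real (C i)) := by
    obtain ⟨d, hd⟩ := h_mesh i
    exact abs_setIntegral_sub_setIntegral_le (hf.integrable μ) (hf.integrable ν) (hf.2 d)
      fun x hx => (hf_lip x d).trans (hd hx)
  have h_int := (hC.hasSum_setIntegral (hf.integrable μ)).sub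
    (hC.hasSum_setIntegral (hf.integrable ν))
  have h_bound := h_summable.hasSum.add ((hμ.add hν).mul_left ε)
  simp only [probReal_univ, one_add_one_eq_two, mul_comm ε 2] at h_bound
  exact abs_le.2 ⟨hasSum_le (fun i => (abs_le.1 (h_cell i)).1) h_bound.neg h_int,
    hasSum_le (fun i => (abs_le.1 (h_cell i)).2) h_int h_bound⟩

variable {E : Type*} [NormedAddCommGroup E] [MeasurableSpace E]

theorem blDist_nonneg (μ ν : Measure E) : 0 ≤ blDist μ ν :=
  Real.iSup_nonneg fun _ => abs_nonneg _

theorem IsMeasurablePartition.ofReal_blDist_le {C : ℕ → Set E} (hC : IsMeasurablePartition C)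
    {ε : ℝ} (hε : 0 ≤ ε) (h_mesh : ∀ i, ∃ d, C i ⊆ Metric.closedBall d ε) (μ ν : Measure E)
    [IsProbabilityMeasure μ] [IsProbabilityMeasure ν] :
    ENNReal.ofReal (blDist μ ν) ≤ partitionDist C μ ν + ENNReal.ofReal (2 * ε) := by
  have h_summable :=
    ((hC.hasSum_measureReal μ).summable.sub (hC.hasSum_measureReal ν).summable).abs
  rw [partitionDist, ← ENNReal.ofReal_tsum_of_nonneg (fun _ => abs_nonneg _) h_summable,
    ← ENNReal.ofReal_add (tsum_nonneg fun _ => abs_nonneg _) (by positivity)]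
  refine ENNReal.ofReal_le_ofReal ?_
  have : Nonempty {f : E → ℝ // Measurable f ∧ (∀ x, |f x| ≤ 1) ∧ ∀ x y, |f x - f y| ≤ ‖x - y‖} :=
    ⟨0, measurable_const, by simp, by simp⟩
  refine ciSup_le fun ⟨f, hf_meas, hf_bdd, hf_lip⟩ => ?_
  exact hC.abs_integral_sub_le h_mesh ⟨hf_meas, hf_bdd⟩ fun x y => by
    simpa only [dist_eq_norm] using hf_lip x y

theorem exists_isMeasurablePartition_subset_closedBall (E : Type*) [PseudoMetricSpace E]
    [TopologicalSpace.SeparableSpace E] [Nonempty E] [MeasurableSpace E] [OpensMeasurableSpace E]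
    {ε : ℝ} (hε : 0 < ε) :
    ∃ C : ℕ → Set E, IsMeasurablePartition C ∧ ∀ i, ∃ d, C i ⊆ Metric.closedBall d ε := by
  let d := TopologicalSpace.denseSeq E
  refine ⟨disjointed fun i => Metric.ball (d i) ε,
    ⟨MeasurableSet.disjointed fun _ => measurableSet_ball, disjoint_disjointed _, ?_⟩,
    fun i => ⟨d i, (disjointed_subset _ i).trans Metric.ball_subset_closedBall⟩⟩
  rw [iUnion_disjointed, Set.eq_univ_iff_forall]
  intro x
  obtain ⟨i, hi⟩ := (TopologicalSpace.denseRange_denseSeq E).exists_dist_lt x hε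
  exact Set.mem_iUnion.2 ⟨i, hi⟩

end BoundedLipschitz

section EmpiricalPartition

variable {T : Type*} [MeasurableSpace T] {κ : Kernel T T} {μ : Measure T} {ρ : Measure (ℕ → T)}
  [IsProbabilityMeasure μ] [IsProbabilityMeasure ρ] {C : ℕ → Set T}

/-- The first `n` sets of the partition are handled by the second moment of the time averages, the
others only by stationarity. -/
theorem IsStationaryChain.lintegral_partitionDist_empiricalDist_le [IsMarkovKernel κ]
    (hρ : IsStationaryChain κ μ ρ) (h_inv : Kernel.Invariant κ μ) (hC : ∀ i, MeasurableSet (C i))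
    (hd : Pairwise (Function.onFun Disjoint C)) {k m : ℕ} (hk : 0 < k) (hm : 0 < m) (n : ℕ) :
    ∫⁻ θ, partitionDist C μ (empiricalDist m θ) ∂ρ ≤
      ∑ i ∈ Finset.range n, ENNReal.ofReal
          √(2 * (ergodicDefect κ μ k (centeredIndicator μ (C i)) + k / m)) +
        2 * μ (⋃ i, C (i + n)) := by
  have h_diff (i : ℕ) : BddMeasurable (|μ.real (C i)| + 1)
      fun θ : ℕ → T => |μ.real (C i) - (empiricalDist m θ).real (C i)| :=
    ((BddMeasurable.const _).sub (bddMeasurable_measureReal_empiricalDist hm (hC i))).abs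
  have h_lintegral (i : ℕ) :
      ∫⁻ θ, ENNReal.ofReal |μ.real (C i) - (empiricalDist m θ).real (C i)| ∂ρ =
        ENNReal.ofReal (∫ θ, |μ.real (C i) - (empiricalDist m θ).real (C i)| ∂ρ) :=
    (ofReal_integral_eq_lintegral_ofReal ((h_diff i).integrable _)
      (ae_of_all _ fun _ => abs_nonneg _)).symm
  simp only [partitionDist]
  rw [lintegral_tsum fun i => (h_diff i).1.ennreal_ofReal.aemeasurable,
    ← ENNReal.summable.sum_add_tsum_nat_add' (k := n)]
  simp only [h_lintegral]
  rw [← tsum_measure_add hC hd, ← ENNReal.tsum_mul_left]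
  refine add_le_add (Finset.sum_le_sum fun i _ => ENNReal.ofReal_le_ofReal
    (hρ.integral_abs_measureReal_sub_le h_inv (hC i) hk hm)) (ENNReal.tsum_le_tsum fun i => ?_)
  calc ENNReal.ofReal (∫ θ, |μ.real (C (i + n)) - (empiricalDist m θ).real (C (i + n))| ∂ρ)
      ≤ ENNReal.ofReal (2 * μ.real (C (i + n))) :=
        ENNReal.ofReal_le_ofReal (hρ.integral_abs_measureReal_sub_le_two_mul hm (hC _))
    _ = 2 * μ (C (i + n)) := by
        rw [ENNReal.ofReal_mul zero_le_two, ENNReal.ofReal_ofNat, ofReal_measureReal]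

end EmpiricalPartition

/-! ### Chains close to an irreducible kernel -/

section UniformBound

variable {T E : Type*} [MeasurableSpace T] [MeasurableSpace E] {κ : Kernel E E} {μ : Measure E}
  [IsMarkovKernel κ] [IsProbabilityMeasure μ] {C : ℕ → Set E}

theorem IsCloseAlong.lintegral_partitionDist_le {l : T → E} {κ' : Kernel T T} [IsMarkovKernel κ']
    {μ' : Measure T} [IsProbabilityMeasure μ'] {ρ : Measure (ℕ → T)} [IsProbabilityMeasure ρ]
    {δ : ℝ} (h_close : IsCloseAlong l κ' μ' κ μ δ) (hl : Measurable l)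
    (h_inv : Kernel.Invariant κ' μ') (hρ : IsStationaryChain κ' μ' ρ)
    (hC : ∀ i, MeasurableSet (C i)) (hd : Pairwise (Function.onFun Disjoint C)) {k m : ℕ}
    (hk : 0 < k) (hm : 0 < m) (n : ℕ) :
    ∫⁻ θ, partitionDist C (μ'.map l) ((empiricalDist m θ).map l) ∂ρ ≤
      ∑ i ∈ Finset.range n, ENNReal.ofReal
          √(2 * (ergodicDefect κ μ k (centeredIndicator μ (C i)) + (k + 2) * δ + k / m)) +
        2 * (μ (⋃ i, C (i + n)) + ENNReal.ofReal δ) := by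
  simp only [partitionDist_map hC hl]
  refine (hρ.lintegral_partitionDist_empiricalDist_le h_inv (fun i => hl (hC i))
    (fun i j hij => (hd hij).preimage l) hk hm n).trans ?_
  have h_tail : μ' (⋃ i, l ⁻¹' C (i + n)) ≤ μ (⋃ i, C (i + n)) + ENNReal.ofReal δ := by
    have hU : MeasurableSet (⋃ i, C (i + n)) := .iUnion fun i => hC (i + n)
    have h_mass := (abs_le.1 (h_close.abs_measureReal_sub_le hl hU)).1
    have h_nonneg : 0 ≤ δ := (tvDist_nonneg _ _).trans h_close.tvDist_le
    rw [← Set.preimage_iUnion, ← ofReal_measureReal, ← ofReal_measureReal,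
      ← ENNReal.ofReal_add measureReal_nonneg h_nonneg]
    exact ENNReal.ofReal_le_ofReal (by linarith)
  refine add_le_add (Finset.sum_le_sum fun i _ => ?_) (mul_le_mul_right h_tail 2)
  have h_defect := h_close.ergodicDefect_centeredIndicator_le hl h_inv (hC i) hk
  exact ENNReal.ofReal_le_ofReal (Real.sqrt_le_sqrt (by linarith))

variable {φ : Measure E}

theorem exists_forall_ergodicDefect_centeredIndicator_le (h_inv : Kernel.Invariant κ μ)
    (hφ : φ ≠ 0) (h_irr : Kernel.IsIrreducible φ κ) (hC : ∀ i, MeasurableSet (C i)) (n : ℕ)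
    {ε : ℝ} (hε : 0 < ε) :
    ∃ k : ℕ, 0 < k ∧
      ∀ i ∈ Finset.range n, ergodicDefect κ μ k (centeredIndicator μ (C i)) ≤ ε := by
  have h_ev : ∀ᶠ k in atTop,
      ∀ i ∈ Finset.range n, ergodicDefect κ μ k (centeredIndicator μ (C i)) ≤ ε :=
    (Finset.eventually_all _).2 fun i _ =>
      (tendsto_ergodicDefect h_inv hφ h_irr (bddMeasurable_centeredIndicator (hC i))
        (integral_centeredIndicator (hC i))).eventually_le_const hε
  exact ((eventually_gt_atTop 0).and h_ev).exists

universe u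

theorem exists_forall_isCloseAlong_lintegral_partitionDist_le (h_inv : Kernel.Invariant κ μ)
    (hφ : φ ≠ 0) (h_irr : Kernel.IsIrreducible φ κ) (hC : ∀ i, MeasurableSet (C i))
    (hd : Pairwise (Function.onFun Disjoint C)) {η : ℝ} (hη : 0 < η) :
    ∃ δ > 0, ∃ m₀ : ℕ, ∀ (T : Type u) [MeasurableSpace T] (l : T → E) (κ' : Kernel T T)
      [IsMarkovKernel κ'] (μ' : Measure T) [IsProbabilityMeasure μ'] (ρ : Measure (ℕ → T))
      [IsProbabilityMeasure ρ], Measurable l → Kernel.Invariant κ' μ' →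
      IsStationaryChain κ' μ' ρ → IsCloseAlong l κ' μ' κ μ δ → ∀ m ≥ m₀,
        ∫⁻ θ, partitionDist C (μ'.map l) ((empiricalDist m θ).map l) ∂ρ ≤ ENNReal.ofReal η := by
  obtain ⟨n, hn⟩ := ((tendsto_measure_iUnion_add_atTop hC hd μ).eventually_le_const
    (ENNReal.ofReal_pos.2 (by positivity : 0 < η / 8))).exists
  set t : ℝ := η / (2 * (n + 1)) with ht
  have ht_pos : 0 < t := by positivity
  obtain ⟨k, hk, h_defect⟩ := exists_forall_ergodicDefect_centeredIndicator_le h_inv hφ h_irr hC n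
    (by positivity : 0 < t ^ 2 / 8)
  obtain ⟨m₀, hm₀⟩ := eventually_atTop.1 ((eventually_gt_atTop 0).and
    ((tendsto_const_div_atTop_nhds_zero_nat (k : ℝ)).eventually_le_const
      (by positivity : 0 < t ^ 2 / 8)))
  refine ⟨min (η / 8) (t ^ 2 / 8 / (k + 2)), by positivity, m₀, ?_⟩
  intro T _ l κ' _ μ' _ ρ _ hl h_inv' hρ h_close m hm
  set δ := min (η / 8) (t ^ 2 / 8 / (k + 2))
  have hδ_tail : δ ≤ η / 8 := min_le_left _ _
  have hδ_defect : (k + 2) * δ ≤ t ^ 2 / 8 := by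
    rw [← le_div_iff₀' (by positivity)]
    exact min_le_right _ _
  have hnt : n * t ≤ η / 2 := by
    rw [ht, mul_div_assoc', div_le_div_iff₀ (by positivity) two_pos]
    nlinarith
  obtain ⟨hm_pos, hkm⟩ := hm₀ m hm
  calc ∫⁻ θ, partitionDist C (μ'.map l) ((empiricalDist m θ).map l) ∂ρ
      ≤ ∑ i ∈ Finset.range n, ENNReal.ofReal
          √(2 * (ergodicDefect κ μ k (centeredIndicator μ (C i)) + (k + 2) * δ + k / m)) +
        2 * (μ (⋃ i, C (i + n)) + ENNReal.ofReal δ) :=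
        h_close.lintegral_partitionDist_le hl h_inv' hρ hC hd hk hm_pos n
    _ ≤ ∑ _i ∈ Finset.range n, ENNReal.ofReal t +
          2 * (ENNReal.ofReal (η / 8) + ENNReal.ofReal (η / 8)) := by
        refine add_le_add (Finset.sum_le_sum fun i hi => ENNReal.ofReal_le_ofReal ?_)
          (mul_le_mul_right (add_le_add hn (ENNReal.ofReal_le_ofReal hδ_tail)) 2)
        refine Real.sqrt_le_iff.2 ⟨ht_pos.le, ?_⟩
        linarith [h_defect i hi, sq_nonneg t]
    _ = ENNReal.ofReal (n * t + 2 * (η / 8 + η / 8)) := by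
        rw [Finset.sum_const, Finset.card_range, nsmul_eq_mul, ENNReal.ofReal_add (by positivity)
          (by positivity), ENNReal.ofReal_mul (by positivity), ENNReal.ofReal_mul zero_le_two,
          ENNReal.ofReal_add (by positivity) (by positivity), ENNReal.ofReal_natCast,
          ENNReal.ofReal_ofNat]
    _ ≤ ENNReal.ofReal η := ENNReal.ofReal_le_ofReal (by linarith)

end UniformBound

/-! ### Continuity of the limit model in its parameter -/

theorem tendsto_integral_abs_sub_of_tendsto_integral {ι Y : Type*} [MeasurableSpace Y]
    {μ : Measure Y} {F : Filter ι} [F.IsCountablyGenerated] {f : ι → Y → ℝ} {g : Y → ℝ}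
    (hf_nonneg : ∀ i, 0 ≤ᵐ[μ] f i) (hf : ∀ i, Integrable (f i) μ) (hg : Integrable g μ)
    (h_integral : Tendsto (fun i => ∫ y, f i y ∂μ) F (𝓝 (∫ y, g y ∂μ)))
    (h_lim : ∀ᵐ y ∂μ, Tendsto (fun i => f i y) F (𝓝 (g y))) :
    Tendsto (fun i => ∫ y, |f i y - g y| ∂μ) F (𝓝 0) := by
  have h_pos_int (i : ι) : Integrable (fun y => max (g y - f i y) 0) μ := (hg.sub (hf i)).pos_part
  have h_eq (i : ι) : ∫ y, |f i y - g y| ∂μ =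
      ∫ y, f i y ∂μ - ∫ y, g y ∂μ + 2 * ∫ y, max (g y - f i y) 0 ∂μ := by
    have h_abs (y : Y) : |f i y - g y| = f i y - g y + 2 * max (g y - f i y) 0 := by
      rcases le_total (g y) (f i y) with h | h
      · rw [abs_of_nonneg (by linarith), max_eq_right (by linarith)]; ring
      · rw [abs_of_nonpos (by linarith), max_eq_left (by linarith)]; ring
    simp only [h_abs]
    rw [integral_add (f := fun y => f i y - g y) ((hf i).sub hg) ((h_pos_int i).const_mul 2),
      integral_sub (hf i) hg, integral_const_mul]
  have h_pos : Tendsto (fun i => ∫ y, max (g y - f i y) 0 ∂μ) F (𝓝 (∫ _, 0 ∂μ)) := by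
    refine tendsto_integral_filter_of_dominated_convergence (fun y => |g y|)
      (.of_forall fun i => (h_pos_int i).aestronglyMeasurable) (.of_forall fun i => ?_) hg.abs ?_
    · filter_upwards [hf_nonneg i] with y hy
      rw [Real.norm_eq_abs, abs_of_nonneg (le_max_right _ _)]
      exact max_le ((sub_le_self _ hy).trans (le_abs_self _)) (abs_nonneg _)
    · filter_upwards [h_lim] with y hy
      simpa using ((tendsto_const_nhds (x := g y)).sub hy).max (tendsto_const_nhds (x := (0 : ℝ)))
  simp only [h_eq]
  simpa using (h_integral.sub_const (∫ y, g y ∂μ)).add (h_pos.const_mul 2)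

namespace LimitModel

variable {S : Type*} [MeasurableSpace S] {p : ℕ} (L : LimitModel S p)

/-- The law `π(u | s) q(u, v | s) du dv` of the current state and the proposal under the limit
model. -/
noncomputable def pairLaw (σ : S) : Measure (EuclideanSpace ℝ (Fin p) × EuclideanSpace ℝ (Fin p)) :=
  L.target σ ⊗ₘ L.proposal.sectR σ

/-- The Lebesgue density of `pairLaw`. -/
def pairDensity (σ : S) (z : EuclideanSpace ℝ (Fin p) × EuclideanSpace ℝ (Fin p)) : ℝ≥0 :=
  L.targetDensity σ z.1 * L.proposalDensity σ z.1 z.2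

instance (σ : S) : IsProbabilityMeasure (L.pairLaw σ) := by unfold pairLaw; infer_instance

theorem measurable_targetDensity_right (σ : S) : Measurable (L.targetDensity σ) :=
  L.measurable_targetDensity.comp measurable_prodMk_left

theorem measurable_proposalDensity_right (σ : S) :
    Measurable fun z : EuclideanSpace ℝ (Fin p) × EuclideanSpace ℝ (Fin p) =>
      L.proposalDensity σ z.1 z.2 :=
  L.measurable_proposalDensity.comp (by fun_prop : Measurable fun
    z : EuclideanSpace ℝ (Fin p) × EuclideanSpace ℝ (Fin p) => ((σ, z.1), z.2))

theorem measurable_accept_right (σ : S) :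
    Measurable fun z : EuclideanSpace ℝ (Fin p) × EuclideanSpace ℝ (Fin p) =>
      L.accept σ z.1 z.2 :=
  L.measurable_accept.comp (by fun_prop : Measurable fun
    z : EuclideanSpace ℝ (Fin p) × EuclideanSpace ℝ (Fin p) => ((σ, z.1), z.2))

theorem measurable_pairDensity (σ : S) : Measurable (L.pairDensity σ) :=
  ((L.measurable_targetDensity_right σ).comp measurable_fst).mul
    (L.measurable_proposalDensity_right σ)

theorem target_apply (σ : S) :
    L.target σ = volume.withDensity fun u => (L.targetDensity σ u : ℝ≥0∞) := by
  rw [target, Kernel.withDensity_apply _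
    (by exact measurable_coe_nnreal_ennreal.comp L.measurable_targetDensity), Kernel.const_apply]

theorem proposal_sectR (σ : S) : L.proposal.sectR σ =
    (Kernel.const _ volume).withDensity fun u v => (L.proposalDensity σ u v : ℝ≥0∞) := by
  ext1 u
  rw [Kernel.sectR_apply, proposal, Kernel.withDensity_apply _
    (by exact measurable_coe_nnreal_ennreal.comp L.measurable_proposalDensity),
    Kernel.withDensity_apply _
    (by exact measurable_coe_nnreal_ennreal.comp (L.measurable_proposalDensity_right σ)),
    Kernel.const_apply, Kernel.const_apply]

theorem pairLaw_eq_withDensity (σ : S) :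
    L.pairLaw σ = volume.withDensity fun z => (L.pairDensity σ z : ℝ≥0∞) := by
  have hπ : Measurable fun u => (L.targetDensity σ u : ℝ≥0∞) :=
    measurable_coe_nnreal_ennreal.comp (L.measurable_targetDensity_right σ)
  have hq : Measurable (Function.uncurry fun u v => (L.proposalDensity σ u v : ℝ≥0∞)) :=
    measurable_coe_nnreal_ennreal.comp (L.measurable_proposalDensity_right σ)
  have : IsSFiniteKernel ((Kernel.const (EuclideanSpace ℝ (Fin p)) volume).withDensity
      fun u v => (L.proposalDensity σ u v : ℝ≥0∞)) := by
    rw [← proposal_sectR]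
    infer_instance
  rw [pairLaw, proposal_sectR, Measure.compProd_withDensity hq, Measure.compProd_const,
    target_apply, prod_withDensity_left hπ, ← Measure.volume_eq_prod]
  exact (withDensity_mul _ (hπ.comp measurable_fst) hq).symm

theorem integrable_pairDensity (σ : S) : Integrable fun z => (L.pairDensity σ z : ℝ) := by
  have h_one : Integrable (fun _ => (1 : ℝ)) (L.pairLaw σ) := integrable_const _
  rw [pairLaw_eq_withDensity, integrable_withDensity_iff_integrable_smul
    (L.measurable_pairDensity σ)] at h_one
  simpa [NNReal.smul_def] using h_one

theorem integral_pairDensity (σ : S) : ∫ z, (L.pairDensity σ z : ℝ) = 1 := by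
  have h_one : ∫ _, (1 : ℝ) ∂L.pairLaw σ = 1 := by simp
  rw [pairLaw_eq_withDensity, integral_withDensity_eq_integral_smul
    (L.measurable_pairDensity σ)] at h_one
  simpa [NNReal.smul_def] using h_one

variable [TopologicalSpace S] [FirstCountableTopology S] {L} {σ : S}

theorem tendsto_tvDist_pairLaw (hπ : ∀ u, ContinuousAt (fun s => L.targetDensity s u) σ)
    (hq : ∀ u v, ContinuousAt (fun s => L.proposalDensity s u v) σ) :
    Tendsto (fun τ => tvDist (L.pairLaw τ) (L.pairLaw σ)) (𝓝 σ) (𝓝 0) := by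
  have h_scheffe : Tendsto (fun τ => ∫ z, |(L.pairDensity τ z : ℝ) - L.pairDensity σ z|)
      (𝓝 σ) (𝓝 0) := by
    refine tendsto_integral_abs_sub_of_tendsto_integral
      (fun _ => ae_of_all _ fun _ => NNReal.coe_nonneg _) L.integrable_pairDensity
      (L.integrable_pairDensity σ) (by simp only [integral_pairDensity, tendsto_const_nhds])
      (ae_of_all _ fun z => ?_)
    exact (NNReal.continuous_coe.tendsto _).comp ((hπ z.1).mul (hq z.1 z.2))
  refine squeeze_zero (fun _ => tvDist_nonneg _ _) (fun τ => ?_) h_scheffe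
  simp only [pairLaw_eq_withDensity]
  exact tvDist_withDensity_le (L.measurable_pairDensity τ) (L.measurable_pairDensity σ)
    (L.integrable_pairDensity τ) (L.integrable_pairDensity σ)

theorem tendsto_integral_abs_accept_sub (hA : ∀ u v, ContinuousAt (fun s => L.accept s u v) σ) :
    Tendsto (fun τ => ∫ z, |(L.accept τ z.1 z.2 : ℝ) - L.accept σ z.1 z.2| ∂L.pairLaw σ)
      (𝓝 σ) (𝓝 0) := by
  have h_diff (τ : S) := ((bddMeasurable_unitInterval (L.measurable_accept_right τ)).sub
    (bddMeasurable_unitInterval (L.measurable_accept_right σ))).abs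
  rw [← integral_zero (EuclideanSpace ℝ (Fin p) × EuclideanSpace ℝ (Fin p)) ℝ (μ := L.pairLaw σ)]
  refine tendsto_integral_filter_of_dominated_convergence (fun _ => (1 + 1 : ℝ))
    (.of_forall fun τ => (h_diff τ).1.aestronglyMeasurable)
    (.of_forall fun τ => ae_of_all _ (h_diff τ).2) (integrable_const _) (ae_of_all _ fun z => ?_)
  have h_lim : Tendsto (fun τ => |(L.accept τ z.1 z.2 : ℝ) - L.accept σ z.1 z.2|) (𝓝 σ)
      (𝓝 |(L.accept σ z.1 z.2 : ℝ) - L.accept σ z.1 z.2|) :=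
    (((continuous_subtype_val.tendsto _).comp (hA z.1 z.2)).sub_const _).abs
  rwa [sub_self, abs_zero] at h_lim

end LimitModel

/-! ### Local coordinates -/

section LocalCoord

variable {p : ℕ} {Θ : Set (EuclideanSpace ℝ (Fin p))} {D : Matrix (Fin p) (Fin p) ℝ}

theorem localParam_localCoord (hD : IsUnit D.det) (θ₀ θ : Θ) :
    localParam D θ₀ (localCoord D θ₀ θ) = θ := by
  have h_inv : Matrix.toEuclideanCLM (𝕜 := ℝ) D⁻¹ * Matrix.toEuclideanCLM (𝕜 := ℝ) D = 1 := by
    rw [← map_mul, Matrix.nonsing_inv_mul _ hD, map_one]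
  rw [localParam, localCoord, ← mul_apply_eq_comp, h_inv,
    one_apply_eq_self, add_sub_cancel]

theorem localParam_localCoord_mem (hD : IsUnit D.det) (θ₀ θ : Θ) :
    localParam D θ₀ (localCoord D θ₀ θ) ∈ Θ := by
  rw [localParam_localCoord hD]
  exact θ.2

theorem measurable_localParam (D : Matrix (Fin p) (Fin p) ℝ) (θ₀ : Θ) :
    Measurable (localParam D θ₀) := by
  unfold localParam
  fun_prop

theorem measurableEmbedding_localCoord (hΘ : MeasurableSet Θ) (hD : IsUnit D.det) (θ₀ : Θ) :
    MeasurableEmbedding (localCoord D θ₀) := by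
  have := hΘ.standardBorel
  have h_meas : Measurable (localCoord D θ₀) := by
    unfold localCoord
    fun_prop
  refine h_meas.measurableEmbedding fun θ ϑ h => Subtype.ext ?_
  rw [← localParam_localCoord hD θ₀ θ, h, localParam_localCoord hD]

variable {𝒳 : Type*} [MeasurableSpace 𝒳]

open Classical in
/-- The acceptance probability of `M` at a pair of local coordinates. Coordinates need not
correspond to a point of `Θ`; where they do not, the value is that of the given function `A`. -/
noncomputable def localAccept (M : MetropolisHastings 𝒳 Θ) (D : Matrix (Fin p) (Fin p) ℝ) (θ₀ : Θ)
    (A : EuclideanSpace ℝ (Fin p) → EuclideanSpace ℝ (Fin p) → unitInterval) (x : 𝒳)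
    (u v : EuclideanSpace ℝ (Fin p)) : unitInterval :=
  if h : localParam D θ₀ u ∈ Θ ∧ localParam D θ₀ v ∈ Θ then M.accept x ⟨_, h.1⟩ ⟨_, h.2⟩ else A u v

theorem localAccept_localCoord (M : MetropolisHastings 𝒳 Θ) (hD : IsUnit D.det) (θ₀ : Θ)
    (A : EuclideanSpace ℝ (Fin p) → EuclideanSpace ℝ (Fin p) → unitInterval) (x : 𝒳) (θ ϑ : Θ) :
    localAccept M D θ₀ A x (localCoord D θ₀ θ) (localCoord D θ₀ ϑ) = M.accept x θ ϑ := by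
  rw [localAccept,
    dif_pos ⟨localParam_localCoord_mem hD θ₀ θ, localParam_localCoord_mem hD θ₀ ϑ⟩]
  simp only [localParam_localCoord hD]

open Classical in
theorem localAccept_sub (M : MetropolisHastings 𝒳 Θ) (θ₀ : Θ)
    (A : EuclideanSpace ℝ (Fin p) → EuclideanSpace ℝ (Fin p) → unitInterval) (x : 𝒳)
    (u v : EuclideanSpace ℝ (Fin p)) :
    (localAccept M D θ₀ A x u v : ℝ) - A u v =
      if h : localParam D θ₀ u ∈ Θ ∧ localParam D θ₀ v ∈ Θ then
        (M.accept x ⟨_, h.1⟩ ⟨_, h.2⟩ : ℝ) - A u v else 0 := by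
  unfold localAccept
  split_ifs
  · rfl
  · exact sub_self _

theorem measurable_localAccept (hΘ : MeasurableSet Θ) (M : MetropolisHastings 𝒳 Θ) (θ₀ : Θ)
    {A : 𝒳 → EuclideanSpace ℝ (Fin p) → EuclideanSpace ℝ (Fin p) → unitInterval}
    (hA : Measurable fun w : 𝒳 × EuclideanSpace ℝ (Fin p) × EuclideanSpace ℝ (Fin p) =>
      A w.1 w.2.1 w.2.2) :
    Measurable fun w : 𝒳 × EuclideanSpace ℝ (Fin p) × EuclideanSpace ℝ (Fin p) =>
      localAccept M D θ₀ (A w.1) w.1 w.2.1 w.2.2 := by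
  classical
  have h_param := measurable_localParam D θ₀
  set V := {w : 𝒳 × EuclideanSpace ℝ (Fin p) × EuclideanSpace ℝ (Fin p) |
    localParam D θ₀ w.2.1 ∈ Θ ∧ localParam D θ₀ w.2.2 ∈ Θ}
  have hV : MeasurableSet V :=
    (h_param.comp (measurable_fst.comp measurable_snd) hΘ).inter
      (h_param.comp (measurable_snd.comp measurable_snd) hΘ)
  have h_points : Measurable fun w : V =>
      ((w.1.1, (⟨localParam D θ₀ w.1.2.1, w.2.1⟩ : Θ)),
        (⟨localParam D θ₀ w.1.2.2, w.2.2⟩ : Θ)) := by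
    fun_prop
  exact Measurable.dite (M.measurable_accept.comp h_points) (hA.comp measurable_subtype_coe) hV

theorem measurable_localAccept_right (hΘ : MeasurableSet Θ) (M : MetropolisHastings 𝒳 Θ) (θ₀ : Θ)
    {A : EuclideanSpace ℝ (Fin p) → EuclideanSpace ℝ (Fin p) → unitInterval}
    (hA : Measurable fun z : EuclideanSpace ℝ (Fin p) × EuclideanSpace ℝ (Fin p) => A z.1 z.2)
    (x : 𝒳) :
    Measurable fun z : EuclideanSpace ℝ (Fin p) × EuclideanSpace ℝ (Fin p) =>
      localAccept M D θ₀ A x z.1 z.2 := by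
  have h_joint : Measurable fun w : 𝒳 × EuclideanSpace ℝ (Fin p) × EuclideanSpace ℝ (Fin p) =>
      localAccept M D θ₀ A w.1 w.2.1 w.2.2 :=
    measurable_localAccept hΘ M θ₀ (A := fun _ => A) (hA.comp measurable_snd)
  simpa only [Function.comp_def] using h_joint.comp (measurable_prodMk_left (x := x))

end LocalCoord

/-! ### Closeness to the limit model in probability -/

theorem MetropolisHastings.isCloseAlong {𝒳 T S : Type*} [MeasurableSpace 𝒳] [MeasurableSpace T]
    [MeasurableSpace S] {p : ℕ} (M : MetropolisHastings 𝒳 T) (x : 𝒳) (L : LimitModel S p) (σ : S)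
    {l : T → EuclideanSpace ℝ (Fin p)} (hl : MeasurableEmbedding l)
    {A : EuclideanSpace ℝ (Fin p) → EuclideanSpace ℝ (Fin p) → unitInterval}
    (hA : Measurable fun z : EuclideanSpace ℝ (Fin p) × EuclideanSpace ℝ (Fin p) => A z.1 z.2)
    (hA_eq : ∀ θ ϑ, A (l θ) (l ϑ) = M.accept x θ ϑ) :
    IsCloseAlong l (M.kernel.sectR x) (M.target x) (L.kernel.sectR σ) (L.target σ)
      (4 * tvDist ((M.target x ⊗ₘ M.proposal.sectR x).map (Prod.map l l)) (L.pairLaw σ) +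
        2 * ∫ z, |(A z.1 z.2 : ℝ) - L.accept σ z.1 z.2| ∂L.pairLaw σ) := by
  have hll : Measurable (Prod.map l l) := hl.measurable.prodMap hl.measurable
  have h_tv_nonneg := tvDist_nonneg ((M.target x ⊗ₘ M.proposal.sectR x).map (Prod.map l l))
    (L.pairLaw σ)
  have h_int_nonneg : 0 ≤ ∫ z, |(A z.1 z.2 : ℝ) - L.accept σ z.1 z.2| ∂L.pairLaw σ :=
    integral_nonneg fun _ => abs_nonneg _
  have h_target : tvDist ((M.target x).map l) (L.target σ) ≤
      tvDist ((M.target x ⊗ₘ M.proposal.sectR x).map (Prod.map l l)) (L.pairLaw σ) := by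
    have h_map := tvDist_map_le (μ := (M.target x ⊗ₘ M.proposal.sectR x).map (Prod.map l l))
      (ν := L.pairLaw σ) measurable_fst
    rwa [Measure.map_map measurable_fst hll, Prod.map_fst', ← Measure.map_map hl.measurable
      measurable_fst, ← Measure.fst, Measure.fst_compProd, LimitModel.pairLaw, ← Measure.fst,
      Measure.fst_compProd] at h_map
  have h_accepted : (acceptedMove (M.target x) (M.proposal.sectR x) (M.accept x)).map
      (Prod.map l l) = ((M.target x ⊗ₘ M.proposal.sectR x).map (Prod.map l l)).withDensity
        fun z => ENNReal.ofReal (A z.1 z.2) := by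
    rw [← map_withDensity_comp hll (measurable_ofReal_unitInterval hA)]
    simp only [Prod.map_fst, Prod.map_snd, hA_eq]
    rfl
  refine ⟨by linarith, fun h hh => ?_⟩
  have h_act := integral_abs_kernelAct_metropolisKernel_sub_le hl M.measurable_accept x
    L.measurable_accept σ (μ' := M.target x) (μ := L.target σ) hh (Q' := M.proposal)
    (Q := L.proposal)
  rw [h_accepted] at h_act
  have h_accept := tvDist_withDensity_unitInterval_le
    (μ := (M.target x ⊗ₘ M.proposal.sectR x).map (Prod.map l l)) (ν := L.pairLaw σ) hA
    (L.measurable_accept_right σ)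
  exact h_act.trans (by rw [acceptedMove, ← LimitModel.pairLaw]; linarith)

theorem TendstoZeroInProb.tendsto_lintegral {ι : Type*} {Ω : ι → Type*}
    [∀ i, MeasurableSpace (Ω i)] {F : Filter ι} {μ : ∀ i, Measure (Ω i)}
    [∀ i, IsProbabilityMeasure (μ i)] {Y : ∀ i, Ω i → ℝ} {c : ℝ} (h : TendstoZeroInProb F μ Y)
    (hY : ∀ i, BddMeasurable c (Y i)) :
    Tendsto (fun i => ∫⁻ ω, ENNReal.ofReal |Y i ω| ∂μ i) F (𝓝 0) := by
  have h_le (r : ℝ) (i : ι) : ∫⁻ ω, ENNReal.ofReal |Y i ω| ∂μ i ≤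
      ENNReal.ofReal r + ENNReal.ofReal c * μ i {ω | r ≤ |Y i ω|} := by
    have hm : MeasurableSet {ω | r ≤ |Y i ω|} := measurableSet_le measurable_const (hY i).1.abs
    calc ∫⁻ ω, ENNReal.ofReal |Y i ω| ∂μ i
        ≤ ∫⁻ ω, (ENNReal.ofReal r + {ω | r ≤ |Y i ω|}.indicator (fun _ => ENNReal.ofReal c) ω)
            ∂μ i := by
          refine lintegral_mono fun ω => ?_
          by_cases hω : r ≤ |Y i ω|
          · rw [Set.indicator_of_mem (by exact hω)]
            exact (ENNReal.ofReal_le_ofReal ((hY i).2 ω)).trans le_add_self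
          · exact (ENNReal.ofReal_le_ofReal (not_le.1 hω).le).trans le_self_add
      _ = ENNReal.ofReal r + ENNReal.ofReal c * μ i {ω | r ≤ |Y i ω|} := by
          rw [lintegral_add_left measurable_const, lintegral_indicator_const hm, lintegral_const,
            measure_univ, mul_one]
  refine ENNReal.tendsto_nhds_zero.2 fun ε hε => ?_
  obtain ⟨r, hr_pos, hrε⟩ := ENNReal.lt_iff_exists_nnreal_btwn.1 hε
  have h_lim : Tendsto (fun i => ENNReal.ofReal r + ENNReal.ofReal c * μ i {ω | (r : ℝ) ≤ |Y i ω|})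
      F (𝓝 (ENNReal.ofReal r)) := by
    simpa only [mul_zero, add_zero] using (ENNReal.Tendsto.const_mul
      (h r (by exact_mod_cast hr_pos)) (.inr ENNReal.ofReal_ne_top)).const_add (ENNReal.ofReal r)
  rw [ENNReal.ofReal_coe_nnreal] at h_lim
  filter_upwards [h_lim.eventually_le_const hrε] with i hi
  exact (h_le r i).trans (by rwa [ENNReal.ofReal_coe_nnreal])

theorem tendstoZeroInProb_integral_abs {ι Z : Type*} {Ω : ι → Type*} [MeasurableSpace Z]
    [∀ i, MeasurableSpace (Ω i)] {F : Filter ι} [F.IsCountablyGenerated]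
    {μ : ∀ i, Measure (Ω i)} [∀ i, IsProbabilityMeasure (μ i)] {ν : Measure Z} [IsFiniteMeasure ν]
    {Y : ∀ i, Ω i → Z → ℝ} {c : ℝ}
    (hY : ∀ i, BddMeasurable c fun w : Ω i × Z => Y i w.1 w.2)
    (h : ∀ z, TendstoZeroInProb F μ fun i ω => Y i ω z) :
    TendstoZeroInProb F μ fun i ω => ∫ z, |Y i ω z| ∂ν := by
  have h_meas (i : ι) := (hY i).1.abs.ennreal_ofReal
  have h_section (i : ι) (z : Z) : BddMeasurable c fun ω => Y i ω z :=
    (hY i).comp (measurable_prodMk_right (y := z))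
  have h_lim : Tendsto (fun i => ∫⁻ ω, ∫⁻ z, ENNReal.ofReal |Y i ω z| ∂ν ∂μ i) F (𝓝 0) := by
    have h_swap (i : ι) : ∫⁻ ω, ∫⁻ z, ENNReal.ofReal |Y i ω z| ∂ν ∂μ i =
        ∫⁻ z, ∫⁻ ω, ENNReal.ofReal |Y i ω z| ∂μ i ∂ν :=
      lintegral_lintegral_swap (h_meas i).aemeasurable
    simp only [h_swap]
    rw [← lintegral_zero (μ := ν)]
    refine tendsto_lintegral_filter_of_dominated_convergence (fun _ => ENNReal.ofReal c)
      (.of_forall fun i => (h_meas i).lintegral_prod_left')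
      (.of_forall fun i => ae_of_all _ fun z => ?_) ?_
      (ae_of_all _ fun z => (h z).tendsto_lintegral fun i => h_section i z)
    · calc ∫⁻ ω, ENNReal.ofReal |Y i ω z| ∂μ i ≤ ∫⁻ _, ENNReal.ofReal c ∂μ i :=
            lintegral_mono fun ω => ENNReal.ofReal_le_ofReal ((hY i).2 (ω, z))
        _ = ENNReal.ofReal c := by rw [lintegral_const, measure_univ, mul_one]
    · rw [lintegral_const]
      exact ENNReal.mul_ne_top ENNReal.ofReal_ne_top (measure_ne_top _ _)
  intro ε hε
  have hε' : ENNReal.ofReal ε ≠ 0 := (ENNReal.ofReal_pos.2 hε).ne'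
  have h_div := ENNReal.Tendsto.div_const h_lim (.inr hε')
  rw [ENNReal.zero_div] at h_div
  refine tendsto_of_tendsto_of_tendsto_of_le_of_le tendsto_const_nhds h_div (fun _ => zero_le)
    fun i => (measure_mono fun ω (hω : ε ≤ |∫ z, |Y i ω z| ∂ν|) => ?_).trans
      (meas_ge_le_lintegral_div (h_meas i).lintegral_prod_right'.aemeasurable hε'
        ENNReal.ofReal_ne_top)
  have h_int : Integrable (fun z => |Y i ω z|) ν :=
    ((hY i).comp (measurable_prodMk_left (x := ω))).abs.integrable ν
  rw [abs_of_nonneg (integral_nonneg fun _ => abs_nonneg _)] at hω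
  rw [Set.mem_ofPred_eq,
    ← ofReal_integral_eq_lintegral_ofReal h_int (ae_of_all _ fun _ => abs_nonneg _)]
  exact ENNReal.ofReal_le_ofReal hω

section Closeness

variable {p : ℕ} {Θ : Set (EuclideanSpace ℝ (Fin p))} {S : Type*} [MeasurableSpace S]

theorem isCloseAlong_localCoord {𝒳 : Type*} [MeasurableSpace 𝒳] {M : MetropolisHastings 𝒳 Θ}
    {L : LimitModel S p} (hΘ : MeasurableSet Θ) {D : Matrix (Fin p) (Fin p) ℝ} (hD : IsUnit D.det)
    {θ₀ : Θ} {x : 𝒳} {σ τ : S} {ε : ℝ}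
    (h_tv : tvDist ((M.target x ⊗ₘ M.proposal.sectR x).map
      (Prod.map (localCoord D θ₀) (localCoord D θ₀))) (L.pairLaw τ) ≤ ε)
    (h_accept : ∫ z, |(localAccept M D θ₀ (L.accept τ) x z.1 z.2 : ℝ) - L.accept τ z.1 z.2|
      ∂L.pairLaw σ ≤ ε)
    (h_tv_limit : tvDist (L.pairLaw τ) (L.pairLaw σ) ≤ ε)
    (h_accept_limit : ∫ z, |(L.accept τ z.1 z.2 : ℝ) - L.accept σ z.1 z.2| ∂L.pairLaw σ ≤ ε) :
    IsCloseAlong (localCoord D θ₀) (M.kernel.sectR x) (M.target x) (L.kernel.sectR σ) (L.target σ)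
      (12 * ε) := by
  have hl := measurableEmbedding_localCoord hΘ hD θ₀
  have h_local :=
    measurable_localAccept_right (D := D) hΘ M θ₀ (L.measurable_accept_right τ) x
  have : IsProbabilityMeasure ((M.target x ⊗ₘ M.proposal.sectR x).map
      (Prod.map (localCoord D θ₀) (localCoord D θ₀))) :=
    Measure.isProbabilityMeasure_map (hl.measurable.prodMap hl.measurable).aemeasurable
  have hA' := bddMeasurable_unitInterval h_local
  have hAτ := bddMeasurable_unitInterval (L.measurable_accept_right τ)
  have hAσ := bddMeasurable_unitInterval (L.measurable_accept_right σ)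
  have h_tv_le := tvDist_triangle ((M.target x ⊗ₘ M.proposal.sectR x).map
    (Prod.map (localCoord D θ₀) (localCoord D θ₀))) (L.pairLaw τ) (L.pairLaw σ)
  have h_accept_le :
      ∫ z, |(localAccept M D θ₀ (L.accept τ) x z.1 z.2 : ℝ) - L.accept σ z.1 z.2| ∂L.pairLaw σ ≤
        ε + ε := by
    calc ∫ z, |(localAccept M D θ₀ (L.accept τ) x z.1 z.2 : ℝ) - L.accept σ z.1 z.2| ∂L.pairLaw σ
        ≤ ∫ z, (|(localAccept M D θ₀ (L.accept τ) x z.1 z.2 : ℝ) - L.accept τ z.1 z.2| +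
            |(L.accept τ z.1 z.2 : ℝ) - L.accept σ z.1 z.2|) ∂L.pairLaw σ :=
          integral_mono ((hA'.sub hAσ).abs.integrable _)
            (((hA'.sub hAτ).abs.add (hAτ.sub hAσ).abs).integrable _) fun z => abs_sub_le _ _ _
      _ ≤ ε + ε := by
          rw [integral_add ((hA'.sub hAτ).abs.integrable _) ((hAτ.sub hAσ).abs.integrable _)]
          exact add_le_add h_accept h_accept_limit
  refine (M.isCloseAlong x L σ hl h_local (localAccept_localCoord M hD θ₀ (L.accept τ) x)).mono ?_
  linarith

theorem tendstoZeroInProb_integral_abs_localAccept_sub {𝒳 : ℕ → Type*}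
    [∀ N, MeasurableSpace (𝒳 N)] {P : ∀ N, Measure (𝒳 N)} [∀ N, IsProbabilityMeasure (P N)]
    {M : ∀ N, MetropolisHastings (𝒳 N) Θ} {L : LimitModel S p}
    {D : ℕ → Matrix (Fin p) (Fin p) ℝ} {θ₀ : Θ} {s : ∀ N, 𝒳 N → S} (hΘ : MeasurableSet Θ)
    (hs : ∀ N, Measurable (s N))
    (h_accept : ∀ u v, TendstoZeroInProb atTop P fun N x =>
      (localAccept (M N) (D N) θ₀ (L.accept (s N x)) x u v : ℝ) - L.accept (s N x) u v) (σ : S) :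
    TendstoZeroInProb atTop P fun N x =>
      ∫ z, |(localAccept (M N) (D N) θ₀ (L.accept (s N x)) x z.1 z.2 : ℝ) -
        L.accept (s N x) z.1 z.2| ∂L.pairLaw σ := by
  refine tendstoZeroInProb_integral_abs (c := 1 + 1) (fun N => ?_) fun z => h_accept z.1 z.2
  have h_limit : Measurable fun w : 𝒳 N × EuclideanSpace ℝ (Fin p) × EuclideanSpace ℝ (Fin p) =>
      L.accept (s N w.1) w.2.1 w.2.2 :=
    L.measurable_accept.comp (by fun_prop : Measurable fun
      w : 𝒳 N × EuclideanSpace ℝ (Fin p) × EuclideanSpace ℝ (Fin p) => ((s N w.1, w.2.1), w.2.2))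
  have h_local := measurable_localAccept (D := D N) hΘ (M N) θ₀
    (A := fun x => L.accept (s N x)) h_limit
  exact ⟨(h_local.subtype_val).sub h_limit.subtype_val, fun w => (abs_sub _ _).trans
    (add_le_add ((abs_of_nonneg (localAccept _ _ _ _ _ _ _).2.1).trans_le
      (localAccept _ _ _ _ _ _ _).2.2)
      ((abs_of_nonneg (L.accept _ _ _).2.1).trans_le (L.accept _ _ _).2.2))⟩

end Closeness

/-! ### Errors that are small uniformly over a set of statistics -/

/-- The expected `partitionDist`, in the coordinate `l`, between the target of `M` and the empirical
distribution of the first `m` states of its chain, given the data `x`. -/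
noncomputable def meanPartitionError {𝒳 T E : Type*} [MeasurableSpace 𝒳] [MeasurableSpace T]
    [MeasurableSpace E] (M : MetropolisHastings 𝒳 T) (l : T → E) (C : ℕ → Set E) (m : ℕ) (x : 𝒳) :
    ℝ≥0∞ :=
  ∫⁻ θ, partitionDist C ((M.target x).map l) ((empiricalDist m θ).map l) ∂M.chain x

/-- With `P N`-probability tending to `1`, a statistic `s N x` in `K` forces `err N m x ≤ η` for all
`m` from some `m₀` on that does not depend on `N`. This notion of smallness passes from
neighbourhoods to compact sets. -/
def EventuallySmallOn {S : Type*} {𝒳 : ℕ → Type*} [∀ N, MeasurableSpace (𝒳 N)]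
    (P : ∀ N, Measure (𝒳 N)) (s : ∀ N, 𝒳 N → S) (err : ∀ N, ℕ → 𝒳 N → ℝ≥0∞) (η : ℝ≥0∞)
    (K : Set S) : Prop :=
  ∃ m₀, Tendsto (fun N => P N {x | s N x ∈ K ∧ ∃ m ≥ m₀, η < err N m x}) atTop (𝓝 0)

namespace EventuallySmallOn

variable {S : Type*} {𝒳 : ℕ → Type*} [∀ N, MeasurableSpace (𝒳 N)] {P : ∀ N, Measure (𝒳 N)}
  {s : ∀ N, 𝒳 N → S} {err : ∀ N, ℕ → 𝒳 N → ℝ≥0∞} {η : ℝ≥0∞} {K K' : Set S}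

theorem empty : EventuallySmallOn P s err η ∅ :=
  ⟨0, by simp⟩

theorem mono (h : EventuallySmallOn P s err η K') (hK : K ⊆ K') :
    EventuallySmallOn P s err η K := by
  obtain ⟨m₀, hm₀⟩ := h
  exact ⟨m₀, tendsto_of_tendsto_of_tendsto_of_le_of_le tendsto_const_nhds hm₀ (fun _ => zero_le)
    fun N => measure_mono fun x hx => ⟨hK hx.1, hx.2⟩⟩

theorem union (h : EventuallySmallOn P s err η K) (h' : EventuallySmallOn P s err η K') :
    EventuallySmallOn P s err η (K ∪ K') := by
  obtain ⟨m₀, hm₀⟩ := h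
  obtain ⟨m₁, hm₁⟩ := h'
  have h_sum := hm₀.add hm₁
  rw [add_zero] at h_sum
  refine ⟨max m₀ m₁, tendsto_of_tendsto_of_tendsto_of_le_of_le tendsto_const_nhds h_sum
    (fun _ => zero_le) fun N => (measure_mono ?_).trans (measure_union_le _ _)⟩
  rintro x ⟨hx | hx, m, hm, h_err⟩
  · exact .inl ⟨hx, m, (le_max_left _ _).trans hm, h_err⟩
  · exact .inr ⟨hx, m, (le_max_right _ _).trans hm, h_err⟩

theorem of_isCompact [TopologicalSpace S] (hK : IsCompact K)
    (h : ∀ σ, ∃ U ∈ 𝓝 σ, EventuallySmallOn P s err η U) : EventuallySmallOn P s err η K := by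
  refine hK.induction_on empty (fun _ _ h_sub h' => h'.mono h_sub) (fun _ _ => union) fun σ _ => ?_
  obtain ⟨U, hU, h_small⟩ := h σ
  exact ⟨U, mem_nhdsWithin_of_mem_nhds hU, h_small⟩

end EventuallySmallOn

theorem exists_mem_nhds_eventuallySmallOn {p : ℕ} {Θ : Set (EuclideanSpace ℝ (Fin p))}
    (hΘ : MeasurableSet Θ) {S : Type*} [MeasurableSpace S] [TopologicalSpace S]
    [FirstCountableTopology S] {𝒳 : ℕ → Type*} [∀ N, MeasurableSpace (𝒳 N)]
    {P : ∀ N, Measure (𝒳 N)} [∀ N, IsProbabilityMeasure (P N)] {θ₀ : Θ}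
    {D : ℕ → Matrix (Fin p) (Fin p) ℝ} (hD : ∀ N, IsUnit (D N).det)
    {M : ∀ N, MetropolisHastings (𝒳 N) Θ} {L : LimitModel S p} {s : ∀ N, 𝒳 N → S}
    (hs : ∀ N, Measurable (s N)) {σ : S} {φ : Measure (EuclideanSpace ℝ (Fin p))} (hφ : φ ≠ 0)
    (h_irr : Kernel.IsIrreducible φ (L.kernel.sectR σ))
    (h_inv : Kernel.Invariant (L.kernel.sectR σ) (L.target σ))
    (hπ : ∀ u, ContinuousAt (fun τ => L.targetDensity τ u) σ)
    (hq : ∀ u v, ContinuousAt (fun τ => L.proposalDensity τ u v) σ)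
    (hA : ∀ u v, ContinuousAt (fun τ => L.accept τ u v) σ)
    (h_accept : ∀ u v, TendstoZeroInProb atTop P fun N x =>
      (localAccept (M N) (D N) θ₀ (L.accept (s N x)) x u v : ℝ) - L.accept (s N x) u v)
    (h_tv : TendstoZeroInProb atTop P fun N x =>
      tvDist (((M N).target x ⊗ₘ (M N).proposal.sectR x).map
        (Prod.map (localCoord (D N) θ₀) (localCoord (D N) θ₀))) (L.pairLaw (s N x)))
    {C : ℕ → Set (EuclideanSpace ℝ (Fin p))} (hC : IsMeasurablePartition C)
    {η : ℝ≥0∞} (hη : η ≠ 0) :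
    ∃ U ∈ 𝓝 σ, EventuallySmallOn P s
      (fun N => meanPartitionError (M N) (localCoord (D N) θ₀) C) η U := by
  have : IsMarkovKernel L.kernel := isMarkovKernel_metropolisKernel _ _ L.measurable_accept
  obtain ⟨r, hr, hrη⟩ := ENNReal.lt_iff_exists_nnreal_btwn.1 hη.bot_lt
  obtain ⟨δ, hδ, m₀, hm₀⟩ := exists_forall_isCloseAlong_lintegral_partitionDist_le h_inv hφ h_irr
    hC.measurableSet hC.disjoint (NNReal.coe_pos.2 (ENNReal.coe_pos.1 hr))
  rw [ENNReal.ofReal_coe_nnreal] at hm₀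
  have hε : 0 < δ / 12 := by positivity
  have hU := ((L.tendsto_tvDist_pairLaw hπ hq).eventually_le_const hε).and
    ((L.tendsto_integral_abs_accept_sub hA).eventually_le_const hε)
  refine ⟨_, hU, m₀, ?_⟩
  have h_sum := (h_tv _ hε).add
    (tendstoZeroInProb_integral_abs_localAccept_sub hΘ hs h_accept σ _ hε)
  rw [add_zero] at h_sum
  refine tendsto_of_tendsto_of_tendsto_of_le_of_le tendsto_const_nhds h_sum (fun _ => zero_le)
    fun N => (measure_mono ?_).trans (measure_union_le _ _)
  rintro x ⟨⟨h_tv_limit, h_accept_limit⟩, m, hm, h_err⟩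
  by_contra! h_good
  simp only [Set.mem_union, Set.mem_ofPred_eq, not_or, not_le] at h_good
  have h_close := isCloseAlong_localCoord hΘ (hD N) ((le_abs_self _).trans h_good.1.le)
    ((le_abs_self _).trans h_good.2.le) h_tv_limit h_accept_limit
  rw [mul_div_cancel₀ δ (by norm_num : (12 : ℝ) ≠ 0)] at h_close
  exact (hrη.trans h_err).not_ge (hm₀ Θ (localCoord (D N) θ₀) ((M N).kernel.sectR x)
    ((M N).target x)
    ((M N).chain x) (measurableEmbedding_localCoord hΘ (hD N) θ₀).measurable
    ((M N).invariant_kernel x) ((M N).isStationaryChain_chain x) h_close m hm)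

/-! ### Local consistency -/

theorem compProd_le_measure_add {α β : Type*} [MeasurableSpace α] [MeasurableSpace β]
    (P : Measure α) [IsProbabilityMeasure P] (κ : Kernel α β) [IsMarkovKernel κ] {H : Set (α × β)}
    (hH : MeasurableSet H) (b : ℝ≥0∞) :
    (P ⊗ₘ κ) H ≤ P {x | b < κ x (Prod.mk x ⁻¹' H)} + b := by
  have h_meas : MeasurableSet {x | b < κ x (Prod.mk x ⁻¹' H)} :=
    measurableSet_lt measurable_const (Kernel.measurable_kernel_prodMk_left hH)
  calc (P ⊗ₘ κ) H = ∫⁻ x, κ x (Prod.mk x ⁻¹' H) ∂P := Measure.compProd_apply hH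
    _ ≤ ∫⁻ x, ({x | b < κ x (Prod.mk x ⁻¹' H)}.indicator 1 x + b) ∂P := by
        refine lintegral_mono fun x => ?_
        by_cases hx : b < κ x (Prod.mk x ⁻¹' H)
        · rw [Set.indicator_of_mem (by exact hx)]
          exact prob_le_one.trans le_self_add
        · exact (not_lt.1 hx).trans le_add_self
    _ = P {x | b < κ x (Prod.mk x ⁻¹' H)} + b := by
        rw [lintegral_add_right _ measurable_const, lintegral_indicator_one h_meas, lintegral_const,
          measure_univ, mul_one]

theorem measurable_partitionDist_empiricalDist {𝒳 T E : Type*} [MeasurableSpace 𝒳]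
    [MeasurableSpace T] [MeasurableSpace E] (κ : Kernel 𝒳 T) {l : T → E}
    (hl : Measurable l) {C : ℕ → Set E} (hC : ∀ i, MeasurableSet (C i)) {m : ℕ} (hm : 0 < m) :
    Measurable fun z : 𝒳 × (ℕ → T) =>
      partitionDist C ((κ z.1).map l) ((empiricalDist m z.2).map l) := by
  simp only [partitionDist_map hC hl]
  refine Measurable.tsum fun i => (Measurable.abs (.sub ?_ ?_)).ennreal_ofReal
  · exact ((κ.measurable_coe (hl (hC i))).comp measurable_fst).ennreal_toReal
  · exact (bddMeasurable_measureReal_empiricalDist hm (hl (hC i))).1.comp measurable_snd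

section BlDist

variable {E : Type*} [NormedAddCommGroup E] [MeasurableSpace E] {C : ℕ → Set E} {ε : ℝ}

theorem IsMeasurablePartition.ofReal_half_le_partitionDist (hC : IsMeasurablePartition C)
    (hε : 0 < ε) (h_mesh : ∀ i, ∃ d, C i ⊆ Metric.closedBall d (ε / 4)) {μ ν : Measure E}
    [IsProbabilityMeasure μ] [IsProbabilityMeasure ν] (h : ε ≤ blDist μ ν) :
    ENNReal.ofReal (ε / 2) ≤ partitionDist C μ ν := by
  have h_le := (ENNReal.ofReal_le_ofReal h).trans
    (hC.ofReal_blDist_le (by positivity) h_mesh μ ν)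
  have h_split : ENNReal.ofReal ε = ENNReal.ofReal (ε / 2) + ENNReal.ofReal (2 * (ε / 4)) := by
    rw [← ENNReal.ofReal_add (by positivity) (by positivity)]
    congr 1
    ring
  rw [h_split] at h_le
  exact ENNReal.le_of_add_le_add_right ENNReal.ofReal_ne_top h_le

theorem MetropolisHastings.compProd_chain_le_blDist_le {𝒳 T : Type*} [MeasurableSpace 𝒳]
    [MeasurableSpace T] (M : MetropolisHastings 𝒳 T) (P : Measure 𝒳) [IsProbabilityMeasure P]
    {l : T → E} (hl : Measurable l) (hC : IsMeasurablePartition C) (hε : 0 < ε)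
    (h_mesh : ∀ i, ∃ d, C i ⊆ Metric.closedBall d (ε / 4)) {m : ℕ} (hm : 0 < m) (b : ℝ≥0∞) :
    (P ⊗ₘ M.chain) {z | ε ≤ |blDist ((M.target z.1).map l) ((empiricalDist m z.2).map l)|} ≤
      P {x | ENNReal.ofReal (ε / 2) * b < meanPartitionError M l C m x} + b := by
  have h_meas := measurable_partitionDist_empiricalDist M.target hl hC.measurableSet hm
  let H : Set (𝒳 × (ℕ → T)) := {z | ENNReal.ofReal (ε / 2) ≤
    partitionDist C ((M.target z.1).map l) ((empiricalDist m z.2).map l)}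
  have h_sub : {z : 𝒳 × (ℕ → T) |
      ε ≤ |blDist ((M.target z.1).map l) ((empiricalDist m z.2).map l)|} ⊆ H := by
    intro z hz
    have := isProbabilityMeasure_empiricalDist hm z.2
    have := Measure.isProbabilityMeasure_map (μ := M.target z.1) hl.aemeasurable
    have := Measure.isProbabilityMeasure_map (μ := empiricalDist m z.2) hl.aemeasurable
    rw [Set.mem_ofPred_eq, abs_of_nonneg (blDist_nonneg _ _)] at hz
    exact hC.ofReal_half_le_partitionDist hε h_mesh hz
  have h_markov (x : 𝒳) : ENNReal.ofReal (ε / 2) * M.chain x (Prod.mk x ⁻¹' H) ≤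
      meanPartitionError M l C m x :=
    mul_meas_ge_le_lintegral (h_meas.comp (measurable_prodMk_left (x := x))) _
  have h_pos : ENNReal.ofReal (ε / 2) ≠ 0 := (ENNReal.ofReal_pos.2 (half_pos hε)).ne'
  refine (measure_mono h_sub).trans ((compProd_le_measure_add P M.chain
    (measurableSet_le measurable_const h_meas) b).trans
      (add_le_add_left (measure_mono fun x hx => ?_) b))
  exact ((ENNReal.mul_lt_mul_iff_right h_pos ENNReal.ofReal_ne_top).2 hx).trans_le (h_markov x)

end BlDist

theorem locallyConsistent_of_eventuallySmallOn {p : ℕ} {Θ : Set (EuclideanSpace ℝ (Fin p))}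
    {S : Type*} [MeasurableSpace S] [TopologicalSpace S] {𝒳 : ℕ → Type*}
    [∀ N, MeasurableSpace (𝒳 N)] {P : ∀ N, Measure (𝒳 N)} [∀ N, IsProbabilityMeasure (P N)]
    {θ₀ : Θ} {D : ℕ → Matrix (Fin p) (Fin p) ℝ} {M : ∀ N, MetropolisHastings (𝒳 N) Θ}
    {s : ∀ N, 𝒳 N → S} (hs : ∀ N, Measurable (s N))
    (h_tight : IsTightMeasureSet (Set.range fun N => (P N).map (s N)))
    (h : ∀ C, IsMeasurablePartition C → ∀ η ≠ 0, ∀ K, IsCompact K → EventuallySmallOn P s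
      (fun N => meanPartitionError (M N) (localCoord (D N) θ₀) C) η K) :
    LocallyConsistent P D θ₀ M := by
  intro ε hε
  refine ENNReal.tendsto_nhds_zero.2 fun δ hδ => ?_
  have hδ_third : 0 < δ / 3 := ENNReal.div_pos hδ.ne' (by norm_num)
  obtain ⟨C, hC, h_mesh⟩ := exists_isMeasurablePartition_subset_closedBall
    (EuclideanSpace ℝ (Fin p)) (by positivity : 0 < ε / 4)
  obtain ⟨K, hK, hKP⟩ :=
    isTightMeasureSet_iff_exists_isCompact_measure_compl_le.1 h_tight (δ / 3) hδ_third
  obtain ⟨m₀, hm₀⟩ := h C hC (ENNReal.ofReal (ε / 2) * (δ / 3))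
    (mul_ne_zero (ENNReal.ofReal_pos.2 (half_pos hε)).ne' hδ_third.ne') K hK
  filter_upwards [(ENNReal.tendsto_nhds_zero.1 hm₀ _ hδ_third).prod_mk
    (eventually_ge_atTop (max m₀ 1))] with ⟨N, m⟩ ⟨h_bad, hm⟩
  have hl : Measurable (localCoord (D N) θ₀) := by
    unfold localCoord
    fun_prop
  have h_err : P N {x | ENNReal.ofReal (ε / 2) * (δ / 3) <
      meanPartitionError (M N) (localCoord (D N) θ₀) C m x} ≤ δ / 3 + δ / 3 := by
    refine (measure_mono fun x hx => ?_).trans ((measure_union_le _ _).trans (add_le_add h_bad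
      ((Measure.le_map_apply (hs N).aemeasurable Kᶜ).trans (hKP _ ⟨N, rfl⟩))))
    by_cases hxK : s N x ∈ K
    · exact .inl ⟨hxK, m, (le_max_left _ _).trans hm, hx⟩
    · exact .inr hxK
  have h_compProd := (M N).compProd_chain_le_blDist_le (P N) hl hC hε h_mesh
    ((le_max_right m₀ 1).trans hm) (δ / 3)
  exact h_compProd.trans ((add_le_add_left h_err _).trans_eq (ENNReal.add_thirds δ))

open Classical in
theorem mainTheorem2_general {p : ℕ} {Θ : Set (EuclideanSpace ℝ (Fin p))} (hΘ : MeasurableSet Θ)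
    {S : Type*} [MeasurableSpace S] [TopologicalSpace S] [FirstCountableTopology S]
    {𝒳 : ℕ → Type*} [∀ N, MeasurableSpace (𝒳 N)] (P : ∀ N, Measure (𝒳 N))
    [∀ N, IsProbabilityMeasure (P N)] (θ₀ : Θ) (D : ℕ → Matrix (Fin p) (Fin p) ℝ)
    (hD : ∀ N, IsUnit (D N).det) (M : ∀ N, MetropolisHastings (𝒳 N) Θ) (L : LimitModel S p)
    (s : ∀ N, 𝒳 N → S) (hs : ∀ N, Measurable (s N))
    (h_irr : ∀ σ, ∃ φ ≠ 0, Kernel.IsIrreducible φ (L.kernel.sectR σ))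
    (h_inv : ∀ σ, Kernel.Invariant (L.kernel.sectR σ) (L.target σ))
    (h_tight : IsTightMeasureSet (Set.range fun N => (P N).map (s N)))
    (hπ : ∀ u, Continuous fun σ => L.targetDensity σ u)
    (hq : ∀ u v, Continuous fun σ => L.proposalDensity σ u v)
    (hA : ∀ u v, Continuous fun σ => L.accept σ u v)
    (h_accept : ∀ u v : EuclideanSpace ℝ (Fin p), TendstoZeroInProb atTop P fun N x =>
      if h : localParam (D N) θ₀ u ∈ Θ ∧ localParam (D N) θ₀ v ∈ Θ then
        ((M N).accept x ⟨_, h.1⟩ ⟨_, h.2⟩ : ℝ) - (L.accept (s N x) u v : ℝ)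
      else 0)
    (h_tv : TendstoZeroInProb atTop P fun N x =>
      tvDist
        (((M N).target x ⊗ₘ (M N).proposal.sectR x).map
          (Prod.map (localCoord (D N) θ₀) (localCoord (D N) θ₀)))
        (L.target (s N x) ⊗ₘ L.proposal.sectR (s N x))) :
    LocallyConsistent P D θ₀ M := by
  simp only [← localAccept_sub] at h_accept
  refine locallyConsistent_of_eventuallySmallOn hs h_tight fun C hC η hη K hK =>
    .of_isCompact hK fun σ => ?_
  obtain ⟨φ, hφ, h_irr⟩ := h_irr σ
  exact exists_mem_nhds_eventuallySmallOn hΘ hD hs hφ h_irr (h_inv σ)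
    (fun u => (hπ u).continuousAt) (fun u v => (hq u v).continuousAt)
    (fun u v => (hA u v).continuousAt) h_accept h_tv hC hη

open Classical in
theorem mainTheorem2
    {p q : ℕ} {Θ : Set (EuclideanSpace ℝ (Fin p))} (hΘ : IsOpen Θ)
    {S : Set (EuclideanSpace ℝ (Fin q))} (hS : IsOpen S)
    -- the experiments, the true parameter and the norming matrices
    {𝒳 : ℕ → Type*} [∀ N, MeasurableSpace (𝒳 N)]
    (P : ∀ N, Θ → Measure (𝒳 N)) [∀ N θ, IsProbabilityMeasure (P N θ)] (θ₀ : Θ)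
    (D : ℕ → Matrix (Fin p) (Fin p) ℝ) (hD : ∀ N, IsUnit (D N).det)
    -- the algorithms, the limit model and the statistics `s_N`
    (M : ∀ N, MetropolisHastings (𝒳 N) Θ) (L : LimitModel S p)
    (s : ∀ N, 𝒳 N → S) (hs : ∀ N, Measurable (s N))
    (h_ergodic : ∀ σ : S, IsErgodicKernel (L.kernel.sectR σ) (L.target σ))
    (h_tight : IsTightMeasureSet (Set.range fun N => (P N θ₀).map (s N)))
    (h_regular : L.IsRegular)
    -- `A_N(θ₀ + D_N⁻¹ u, θ₀ + D_N⁻¹ v | x) - A(u, v | s_N) → 0` in probability for all `u, v`;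
    -- nothing is asked for those `N` for which one of the two points is outside `Θ`
    (h_accept : ∀ u v : EuclideanSpace ℝ (Fin p),
      TendstoZeroInProb atTop (fun N => P N θ₀) fun N x =>
        if h : localParam (D N) θ₀ u ∈ Θ ∧ localParam (D N) θ₀ v ∈ Θ then
          ((M N).accept x ⟨_, h.1⟩ ⟨_, h.2⟩ : ℝ) - (L.accept (s N x) u v : ℝ)
        else 0)
    (h_tv : TendstoZeroInProb atTop (fun N => P N θ₀) fun N x =>
      tvDist
        (((M N).target x ⊗ₘ (M N).proposal.sectR x).map
          (Prod.map (localCoord (D N) θ₀) (localCoord (D N) θ₀)))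
        (L.target (s N x) ⊗ₘ L.proposal.sectR (s N x))) :
    LocallyConsistent (fun N => P N θ₀) D θ₀ M :=
  mainTheorem2_general hΘ.measurableSet (fun N => P N θ₀) θ₀ D hD M L s hs
    (fun σ => (h_ergodic σ).irreducible.imp fun _ h => h.2) (fun σ => (h_ergodic σ).invariant)
    h_tight h_regular.continuous_targetDensity h_regular.continuous_proposalDensity
    h_regular.continuous_accept h_accept h_tv
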